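/- Let $\Omega=(0,1)$, and let $p,q,r\in L^\infty(\Omega)$ satisfy $p\ge p_0>0$ and, with $q'\in L^1_{\rm loc}(\Omega)$ the weak derivative of $q$, $r-\tfrac12 q'\ge\gamma>0$ a.e. in $\Omega$. Consider the boundary value problem $$-(pu')'+qu'+ru=f \ \text{ in } \Omega,\qquad u(0)=u(1)=0, \tag{1}$$ understood in the weak sense, with $f\in L^2(\Omega)$. Fix $k\ge 1$ and points $-1<G_1<\dots<G_k<1$ that are symmetric, $G_{k+1-j}=-G_j$. For a mesh $0=x_0<x_1<\dots<x_N=1$ put $K_i=[x_{i-1},x_i]$, $h_i=x_i-x_{i-1}$, $h=\max_i h_i$, and assume that $p$ is continuous in the interior of each $K_i$. Let $U_h^k$ be the space of $w\in C([0,1])$ with $w(0)=w(1)=0$ whose restriction to each $K_i$ is a polynomial of degree at most $k$. Put $g_{i,j}=\frac12(x_i+x_{i-1}+h_iG_j)$ for $1\le i\le N$, $1\le j\le k$, $g_{i,k+1}=g_{i+1,1}$ for $i<N$, and $g_{N,k+1}=1$. Let $V_h$ be the space of the functions $v_h=\sum_{i=1}^N\sum_{j=1}^k v_{i,j}\chi_{[g_{i,j},g_{i,j+1}]}$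 with real $v_{i,j}$ and $v_{N,k}=0$; put $v_{1,0}=0$, $v_{i,0}=v_{i-1,k}$ for $2\le i\le N$, and $[v_{i,j}]=v_{i,j}-v_{i,j-1}$. An FVE solution is a $u_h\in U_h^k$ such that for all $v_h\in V_h$ $$\sum_{i=1}^N\sum_{j=1}^k [v_{i,j}]\,p(g_{i,j})\,u_h'(g_{i,j})+\sum_{i=1}^N\sum_{j=1}^k v_{i,j}\int_{g_{i,j}}^{g_{i,j+1}}\bigl(q u_h'+r u_h\bigr)\,dx=\int_0^1 f v_h\,dx .$$ Let $H^{m}_{\mathcal T}(\Omega)$ be the set of continuous $w$ with $w|_{K_i}\in H^m(K_i)$ for all $i$, with $\|w\|_{m,\mathcal T}^2=\sum_{j=0}^m\sum_{i=1}^N|w|_{j,K_i}^2$, where $|w|_{j,K_i}$ is the $L^2(K_i)$ norm of the $j$-th weak derivative of $w$ on $K_i$, and let $\|\cdot\|_1$ be the norm of $H^1(\Omega)$. **Theorem.** There are constants $C>0$ and $h_0>0$, depending only on $k$, $G_1,\dots,G_k$ and $p,q,r$, such that for every such mesh with $h\le h_0$ and every $f\in L^2(\Omega)$: if $u\in H_0^1(\Omega)\cap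 H^{k+1}_{\mathcal T}(\Omega)$ is the solution of (1) and $u_h$ is an FVE solution, then $$\|u-u_h\|_{1}\le C\,h^{k}\,\|u\|_{k+1,\mathcal T}.$$ -/

import Mathlib

open MeasureTheory Set
open scoped ContDiff

noncomputable section

namespace FVE

/-! ### Sobolev spaces on a bounded interval `(a, b)` -/

/-- `φ` is a test function on `(a, b)`: smooth, with compact support contained in `(a, b)`. -/
def IsTest (a b : ℝ) (φ : ℝ → ℝ) : Prop :=
  ContDiff ℝ ∞ φ ∧ HasCompactSupport φ ∧ tsupport φ ⊆ Ioo a b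

/-- `g` is the weak derivative of order `j` of `u` on `(a, b)`. -/
def HasWeakDeriv (a b : ℝ) (j : ℕ) (u g : ℝ → ℝ) : Prop :=
  LocallyIntegrableOn u (Ioo a b) ∧ LocallyIntegrableOn g (Ioo a b) ∧
    ∀ φ : ℝ → ℝ, IsTest a b φ →
      ∫ x in Ioo a b, u x * iteratedDeriv j φ x = (-1) ^ j * ∫ x in Ioo a b, g x * φ x

open Classical in
/-- A representative of the weak derivative of order `j` of `u` on `(a, b)` (weak derivatives are
unique up to null sets); the zero function if `u` has no such weak derivative. -/
def weakDeriv (a b : ℝ) (j : ℕ) (u : ℝ → ℝ) : ℝ → ℝ :=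
  if h : ∃ g, HasWeakDeriv a b j u g then h.choose else 0

/-- `u ∈ H^m(a, b)`: all weak derivatives of order at most `m` exist and lie in `L²(a, b)`. -/
def MemSobolev (a b : ℝ) (m : ℕ) (u : ℝ → ℝ) : Prop :=
  ∀ j ≤ m, ∃ g, HasWeakDeriv a b j u g ∧ MemLp g 2 (volume.restrict (Ioo a b))

/-- The square of the Sobolev seminorm, `|u|²_{j,(a,b)}`. -/
def seminormSq (a b : ℝ) (j : ℕ) (u : ℝ → ℝ) : ℝ :=
  ∫ x in Ioo a b, (weakDeriv a b j u x) ^ 2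

/-- The norm of `H^m(a, b)`. -/
def sobolevNorm (a b : ℝ) (m : ℕ) (u : ℝ → ℝ) : ℝ :=
  √(∑ j ∈ Finset.range (m + 1), seminormSq a b j u)

/-- `u ∈ H_0^1(0, 1)`, where `u` is the continuous representative. -/
def MemH01 (u : ℝ → ℝ) : Prop :=
  MemSobolev 0 1 1 u ∧ ContinuousOn u (Icc 0 1) ∧ u 0 = 0 ∧ u 1 = 0

/-! ### The boundary value problem -/

/-- `u` solves `-(p u')' + q u' + r u = f` on `(0, 1)`, `u(0) = u(1) = 0`, in the weak sense. -/
def IsWeakSolution (p q r f u : ℝ → ℝ) : Prop :=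
  MemH01 u ∧ ∀ φ : ℝ → ℝ, IsTest 0 1 φ →
    ∫ x in Ioo (0 : ℝ) 1, (p x * weakDeriv 0 1 1 u x * deriv φ x
        + q x * weakDeriv 0 1 1 u x * φ x + r x * u x * φ x)
      = ∫ x in Ioo (0 : ℝ) 1, f x * φ x

/-! ### Primary mesh and trial space -/

/-- A primary mesh `0 = x_0 < x_1 < ⋯ < x_N = 1` (only the values `x i` with `i ≤ N` matter).
Its elements are `K_i = [x_{i-1}, x_i]`, `1 ≤ i ≤ N`. -/
structure Mesh where
  N : ℕ
  x : ℕ → ℝ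
  x_zero : x 0 = 0
  x_last : x N = 1
  x_lt : ∀ i < N, x i < x (i + 1)

namespace Mesh

variable (T : Mesh)

theorem nonempty_index : (Finset.Icc 1 T.N).Nonempty := by
  rw [Finset.nonempty_Icc, Nat.one_le_iff_ne_zero]
  intro h
  have h0 := T.x_zero
  have h1 := T.x_last
  rw [h] at h1
  linarith

/-- The length `h_i = x_i - x_{i-1}` of the element `K_i`, `1 ≤ i ≤ N`. -/
def len (i : ℕ) : ℝ := T.x i - T.x (i - 1)

/-- The mesh size `h = max h_i`. -/
def h : ℝ := (Finset.Icc 1 T.N).sup' T.nonempty_index T.len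

/-- The trial space `U_h^k`: continuous functions, polynomial of degree at most `k` on each
element, vanishing at `0` and `1`. -/
def MemTrial (k : ℕ) (w : ℝ → ℝ) : Prop :=
  ContinuousOn w (Icc 0 1) ∧ w 0 = 0 ∧ w 1 = 0 ∧
    ∀ i ∈ Finset.Icc 1 T.N, ∃ P : Polynomial ℝ, P.natDegree ≤ k ∧
      ∀ y ∈ Icc (T.x (i - 1)) (T.x i), w y = P.eval y

/-- The broken Sobolev space `H_T^m`. -/
def MemBroken (m : ℕ) (w : ℝ → ℝ) : Prop :=
  ContinuousOn w (Icc 0 1) ∧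
    ∀ i ∈ Finset.Icc 1 T.N, MemSobolev (T.x (i - 1)) (T.x i) m w

/-- The broken Sobolev norm `‖w‖_{m,T}`. -/
def brokenNorm (m : ℕ) (w : ℝ → ℝ) : ℝ :=
  √(∑ j ∈ Finset.range (m + 1), ∑ i ∈ Finset.Icc 1 T.N,
    seminormSq (T.x (i - 1)) (T.x i) j w)

end Mesh

/-! ### Dual mesh and test space -/

/-- `-1 < G_1 < ⋯ < G_k < 1`, symmetric about `0` (only the values `G j` with `1 ≤ j ≤ k`
matter). -/
structure IsSymmDualPoints (k : ℕ) (G : ℕ → ℝ) : Prop where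
  mem : ∀ j ∈ Finset.Icc 1 k, G j ∈ Ioo (-1 : ℝ) 1
  lt : ∀ i ∈ Finset.Icc 1 k, ∀ j ∈ Finset.Icc 1 k, i < j → G i < G j
  symm : ∀ j ∈ Finset.Icc 1 k, G (k + 1 - j) = -G j

namespace Mesh

variable (T : Mesh) (k : ℕ) (G : ℕ → ℝ)

/-- The dual points `g_{i,j}`, `1 ≤ i ≤ N`, `1 ≤ j ≤ k + 1`: affine images of the `G_j` for
`j ≤ k`, while `g_{i,k+1} = g_{i+1,1}` for `i < N` and `g_{N,k+1} = 1`. -/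
def dualPt (i j : ℕ) : ℝ :=
  if j ≤ k then (T.x i + T.x (i - 1) + T.len i * G j) / 2
  else if i < T.N then (T.x (i + 1) + T.x i + T.len (i + 1) * G 1) / 2
  else 1

/-- The coefficients `v_{i,j}`, `1 ≤ i ≤ N`, `0 ≤ j ≤ k`, of an element of the test space `V_h`:
`v_{1,0} = v_{N,k} = 0`, with the convention `v_{i,0} = v_{i-1,k}` for `2 ≤ i ≤ N`. -/
structure IsTestCoeff (v : ℕ → ℕ → ℝ) : Prop where
  first : v 1 0 = 0
  last : v T.N k = 0
  link : ∀ i ∈ Finset.Icc 2 T.N, v i 0 = v (i - 1) k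

/-- The element `v_h = ∑ v_{i,j} χ[g_{i,j}, g_{i,j+1}]` of the test space. -/
def testFun (v : ℕ → ℕ → ℝ) : ℝ → ℝ := fun y =>
  ∑ i ∈ Finset.Icc 1 T.N, ∑ j ∈ Finset.Icc 1 k,
    (Icc (T.dualPt k G i j) (T.dualPt k G i (j + 1))).indicator (fun _ => v i j) y

/-- The bilinear form `a_h(w, v_h)` of the scheme, with the jump `[v_{i,j}] = v_{i,j} - v_{i,j-1}`
at `g_{i,j}`. -/
def form (p q r w : ℝ → ℝ) (v : ℕ → ℕ → ℝ) : ℝ :=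
  (∑ i ∈ Finset.Icc 1 T.N, ∑ j ∈ Finset.Icc 1 k,
      (v i j - v i (j - 1)) * (p (T.dualPt k G i j) * deriv w (T.dualPt k G i j)))
  + ∑ i ∈ Finset.Icc 1 T.N, ∑ j ∈ Finset.Icc 1 k,
      v i j * ∫ y in (T.dualPt k G i j)..(T.dualPt k G i (j + 1)), (q y * deriv w y + r y * w y)

/-- `w` is an FVE solution: `w ∈ U_h^k` and `a_h(w, v_h) = (f, v_h)` for all `v_h ∈ V_h`. -/
def IsFVESolution (p q r f w : ℝ → ℝ) : Prop :=
  T.MemTrial k w ∧ ∀ v : ℕ → ℕ → ℝ, T.IsTestCoeff k v →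
    T.form k G p q r w v = ∫ y in Ioo (0 : ℝ) 1, f y * T.testFun k G v y

end Mesh

end FVE

end

/-!
Write `e = u - u_h`, `d = e'` and `Q(x) = ∫_0^x (q d + r e)`. The argument works with the error
itself and needs neither an inf-sup condition nor positive quadrature weights at the dual points.

* Flux balance. Testing the scheme with the characteristic function of one dual cell shows that
  `p u_h'` minus the primitive of `q u_h' + r u_h - f` takes the same value at all dual points. The
  weak form of the differential equation and the du Bois-Reymond lemma give the same for `p u'`. So
  `p(g) d(g) = c + Q(g)` at every dual point `g`, with one constant `c` (`exists_nodal_flux`).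
* Coercivity. Let `R = p d - c - Q` be the defect of this balance at arbitrary points. As
  `((c + Q) e)' = (c + Q) d + (q d + r e) e` has integral zero, `∫ (p d² + q d e + r e²) = ∫ R d`;
  the lower-order part is nonnegative (`integral_lowerOrder_nonneg`), hence `p₀ ‖d‖ ≤ ‖R‖`
  (`IsAdmissible.sq_mul_integral_sq_le`). As `d = (c + Q + R) / p` has mean zero, `c` and with it
  the nodal values of `d` are bounded by `‖R‖` as well (`IsAdmissible.sq_const_le`,
  `IsAdmissible.sq_nodal_le`).
* Self-bounding of `R`. On an element `u'` is within `O(h^{k-1/2})` of a polynomial of degree less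
  than `k` (`exists_polynomial_approx`), so up to that error `d` is the Lagrange interpolant
  `∑ ℓ_j d(g_j)` of its nodal values. As `∑ ℓ_j = 1`, up to the same error
  `R(x) = ∑ ℓ_j(x) ((p(x) - p(g_j)) d(g_j) + Q(g_j) - Q(x))`. Here `Q` is Hölder continuous with
  exponent `1/2` and a constant that is a multiple of `‖d‖`, and the mean square of `p(x) - p(g_j)`
  tends to zero with the mesh size, uniformly over the admissible meshes, by dominated convergence
  (`Mesh.exists_oscillation_le`). Thus `‖R‖² ≤ ‖R‖² / 2 + C h^{2k} ‖u‖²` for small `h`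
  (`IsAdmissible.integral_sq_fluxDefect_le`).
-/

/-! ### Indefinite integrals of integrable functions -/

namespace FVE

/-- `F` is absolutely continuous on `[a, b]` with almost everywhere derivative `f`, expressed as
`F` being an indefinite integral of `f`. -/
structure IsPrimitive (a b : ℝ) (F f : ℝ → ℝ) : Prop where
  integrable : IntervalIntegrable f volume a b
  eq : ∀ x ∈ Icc a b, F x = F a + ∫ t in a..x, f t

namespace IsPrimitive

variable {a b : ℝ} {F f G g : ℝ → ℝ}

theorem integrable_sub (h : IsPrimitive a b F f) {c d : ℝ} (hc : c ∈ Icc a b) (hd : d ∈ Icc a b) :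
    IntervalIntegrable f volume c d := by
  refine h.integrable.mono_set ?_
  rw [uIcc_of_le (hc.1.trans hc.2)]
  exact uIcc_subset_Icc hc hd

theorem sub_eq (h : IsPrimitive a b F f) {c d : ℝ} (hc : c ∈ Icc a b) (hd : d ∈ Icc a b) :
    F d - F c = ∫ t in c..d, f t := by
  have ha : a ∈ Icc a b := ⟨le_rfl, hc.1.trans hc.2⟩
  rw [h.eq d hd, h.eq c hc,
    ← intervalIntegral.integral_add_adjacent_intervals (h.integrable_sub ha hc)
      (h.integrable_sub hc hd)]
  ring

theorem mono (h : IsPrimitive a b F f) {c d : ℝ} (hc : c ∈ Icc a b) (hd : d ∈ Icc a b) :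
    IsPrimitive c d F f := by
  refine ⟨h.integrable_sub hc hd, fun x hx => ?_⟩
  rw [← h.sub_eq hc ⟨hc.1.trans hx.1, hx.2.trans hd.2⟩]
  ring

theorem continuousOn (h : IsPrimitive a b F f) : ContinuousOn F (Icc a b) := by
  rcases le_or_gt a b with hab | hab
  · have h1 : ContinuousOn (fun x => F a + ∫ t in a..x, f t) (Icc a b) := by
      refine continuousOn_const.add ?_
      have := intervalIntegral.continuousOn_primitive_interval (μ := volume) (f := f) (a := a)
        (b := b) (by
          rw [uIcc_of_le hab, integrableOn_Icc_iff_integrableOn_Ioc]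
          exact (intervalIntegrable_iff_integrableOn_Ioc_of_le hab).1 h.integrable)
      rwa [uIcc_of_le hab] at this
    exact h1.congr h.eq
  · rw [Icc_eq_empty (not_le.2 hab)]
    exact continuousOn_empty _

theorem congr_ae (h : IsPrimitive a b F f) (hab : a ≤ b)
    (hfg : ∀ᵐ x ∂(volume.restrict (Ioo a b)), f x = g x) : IsPrimitive a b F g := by
  have hfg' : ∀ᵐ x ∂(volume.restrict (Ioc a b)), f x = g x := by
    rwa [← Measure.restrict_congr_set (Ioo_ae_eq_Ioc (μ := volume) (a := a) (b := b))]
  refine ⟨?_, fun x hx => ?_⟩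
  · refine h.integrable.congr_ae ?_
    rw [uIoc_of_le hab]
    exact hfg'
  · rw [h.eq x hx]
    congr 1
    refine intervalIntegral.integral_congr_ae ?_
    rw [uIoc_of_le hx.1]
    have := (ae_restrict_iff' measurableSet_Ioc).1 hfg'
    filter_upwards [this] with y hy hy'
    exact hy ⟨hy'.1, hy'.2.trans hx.2⟩

theorem sub (hF : IsPrimitive a b F f) (hG : IsPrimitive a b G g) :
    IsPrimitive a b (fun x => F x - G x) (fun x => f x - g x) := by
  refine ⟨hF.integrable.sub hG.integrable, fun x hx => ?_⟩
  have ha : a ∈ Icc a b := ⟨le_rfl, hx.1.trans hx.2⟩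
  rw [intervalIntegral.integral_sub (hF.integrable_sub ha hx) (hG.integrable_sub ha hx)]
  have := hF.eq x hx
  have := hG.eq x hx
  linarith

theorem mul (hab : a ≤ b) (hF : IsPrimitive a b F f) (hG : IsPrimitive a b G g) :
    IsPrimitive a b (fun x => F x * G x) (fun x => f x * G x + F x * g x) := by
  have key : ∀ {H h' : ℝ → ℝ}, IsPrimitive a b H h' →
      AbsolutelyContinuousOnInterval (fun x => H a + ∫ t in a..x, h' t) a b := by
    intro H h' hH
    have h1 := hH.integrable.absolutelyContinuousOnInterval_intervalIntegral
      (c := a) left_mem_uIcc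
    have h2 : AbsolutelyContinuousOnInterval (fun _ : ℝ => H a) a b :=
      (LipschitzWith.const (H a)).lipschitzOnWith.absolutelyContinuousOnInterval
    exact h2.add h1
  have hd : ∀ {H h' : ℝ → ℝ}, IsPrimitive a b H h' →
      ∀ᵐ x, x ∈ Icc a b → deriv (fun x => H a + ∫ t in a..x, h' t) x = h' x := by
    intro H h' hH
    filter_upwards [hH.integrable.ae_hasDerivAt_integral] with x hx hxab
    rw [uIcc_of_le hab] at hx
    exact ((hx hxab a ⟨le_rfl, hab⟩).const_add (H a)).deriv
  refine ⟨?_, fun x hx => ?_⟩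
  · refine (hF.integrable.mul_continuousOn ?_).add (hG.integrable.continuousOn_mul ?_)
    · rw [uIcc_of_le hab]; exact hG.continuousOn
    · rw [uIcc_of_le hab]; exact hF.continuousOn
  · have hsub : uIcc a x ⊆ uIcc a b := by
      rw [uIcc_of_le hab, uIcc_of_le hx.1]; exact Icc_subset_Icc_right hx.2
    have := AbsolutelyContinuousOnInterval.integral_deriv_mul_eq_sub
      ((key hF).mono hsub) ((key hG).mono hsub)
    simp only [intervalIntegral.integral_same, add_zero] at this
    rw [← hF.eq x hx, ← hG.eq x hx] at this
    have h2 : ∫ t in a..x, (f t * G t + F t * g t) = F x * G x - F a * G a := by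
      rw [← this]
      refine intervalIntegral.integral_congr_ae ?_
      filter_upwards [hd hF, hd hG] with y hy1 hy2 hy
      rw [uIoc_of_le hx.1] at hy
      have hy' : y ∈ Icc a b := ⟨hy.1.le, hy.2.trans hx.2⟩
      rw [hy1 hy', hy2 hy', ← hF.eq y hy', ← hG.eq y hy']
    rw [h2]; ring

end IsPrimitive

end FVE

/-! ### Test functions and the du Bois-Reymond lemma -/

namespace FVE

variable {a b : ℝ} {φ ψ u g : ℝ → ℝ}

theorem IsTest.deriv (hφ : IsTest a b φ) : IsTest a b (deriv φ) :=
  ⟨(contDiff_infty_iff_deriv.1 hφ.1).2, hφ.2.1.deriv,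
    (closure_minimal (support_deriv_subset) (isClosed_tsupport φ)).trans hφ.2.2⟩

theorem IsTest.continuous (hφ : IsTest a b φ) : Continuous φ := hφ.1.continuous

theorem IsTest.hasDerivAt (hφ : IsTest a b φ) (x : ℝ) : HasDerivAt φ (_root_.deriv φ x) x :=
  (hφ.1.differentiable (by simp) x).hasDerivAt

theorem IsTest.isPrimitive (hφ : IsTest a b φ) (c d : ℝ) :
    IsPrimitive c d φ (_root_.deriv φ) := by
  refine ⟨hφ.deriv.continuous.intervalIntegrable _ _, fun x _ => ?_⟩
  rw [intervalIntegral.integral_eq_sub_of_hasDerivAt (fun y _ => hφ.hasDerivAt y)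
    (hφ.deriv.continuous.intervalIntegrable _ _)]
  ring

theorem IsTest.mono {c d : ℝ} (hφ : IsTest c d φ) (hc : a ≤ c) (hd : d ≤ b) : IsTest a b φ :=
  ⟨hφ.1, hφ.2.1, hφ.2.2.trans (Ioo_subset_Ioo hc hd)⟩

/-- The support of a test function on `(a, b)` keeps away from the end points. -/
theorem IsTest.exists_tsupport_subset (hφ : IsTest a b φ) {x₀ : ℝ} (hx₀ : x₀ ∈ Ioo a b) :
    ∃ α ∈ Ioo a b, ∃ β ∈ Ioo a b, α < x₀ ∧ x₀ < β ∧ tsupport φ ⊆ Ioo α β := by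
  have hK : IsCompact (insert x₀ (tsupport φ)) := hφ.2.1.isCompact.insert x₀
  have hne : (insert x₀ (tsupport φ)).Nonempty := ⟨x₀, mem_insert _ _⟩
  have hsub : insert x₀ (tsupport φ) ⊆ Ioo a b := insert_subset hx₀ hφ.2.2
  obtain ⟨m, hm, hm'⟩ := hK.exists_isLeast hne
  obtain ⟨M, hM, hM'⟩ := hK.exists_isGreatest hne
  have h1 := hsub hm
  have h2 := hsub hM
  have h3 := hm' (mem_insert x₀ _)
  have h4 := hM' (mem_insert x₀ _)
  refine ⟨(a + m) / 2, ⟨?_, ?_⟩, (M + b) / 2, ⟨?_, ?_⟩, ?_, ?_, fun y hy => ⟨?_, ?_⟩⟩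
  all_goals try linarith [h1.1, h1.2, h2.1, h2.2]
  · linarith [hm' (mem_insert_of_mem x₀ hy), h1.1]
  · linarith [hM' (mem_insert_of_mem x₀ hy), h2.2]

theorem setIntegral_Ioo_eq_of_forall_notMem_eq_zero {f : ℝ → ℝ} {α β : ℝ} (ha : a ≤ α) (hb : β ≤ b)
    (hαβ : α ≤ β) (hf : ∀ x ∉ Ioo α β, f x = 0) :
    ∫ x in Ioo a b, f x = ∫ x in α..β, f x := by
  rw [intervalIntegral.integral_of_le hαβ, integral_Ioc_eq_integral_Ioo]
  exact (setIntegral_eq_of_subset_of_forall_sdiff_eq_zero measurableSet_Ioo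
    (Ioo_subset_Ioo ha hb) (fun x hx => hf x hx.2))

theorem eq_zero_of_tsupport_subset {s : Set ℝ} (h : tsupport φ ⊆ s) {x : ℝ} (hx : x ∉ s) :
    φ x = 0 :=
  image_eq_zero_of_notMem_tsupport (fun h' => hx (h h'))

theorem intervalIntegrable_of_locallyIntegrableOn (hu : LocallyIntegrableOn u (Ioo a b)) {c d : ℝ}
    (hc : c ∈ Ioo a b) (hd : d ∈ Ioo a b) : IntervalIntegrable u volume c d := by
  refine intervalIntegrable_iff.2 ?_
  exact (hu.integrableOn_compact_subset (ordConnected_Ioo.uIcc_subset hc hd)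
    isCompact_uIcc).mono_set uIoc_subset_uIcc

theorem integrableOn_mul_test (hu : LocallyIntegrableOn u (Ioo a b)) (hφ : IsTest a b φ) :
    IntegrableOn (fun x => u x * φ x) (Ioo a b) := by
  have h1 : IntegrableOn (fun x => u x * φ x) (tsupport φ) :=
    (hu.integrableOn_compact_subset hφ.2.2 hφ.2.1.isCompact).mul_continuousOn
      hφ.continuous.continuousOn hφ.2.1.isCompact
  refine h1.of_forall_sdiff_eq_zero measurableSet_Ioo (fun x hx => ?_)
  simp [image_eq_zero_of_notMem_tsupport hx.2]

/-- Integration by parts against test functions for locally absolutely continuous functions. -/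
theorem integral_mul_deriv_test {F f : ℝ → ℝ}
    (hF : ∀ c ∈ Ioo a b, ∀ d ∈ Ioo a b, IsPrimitive c d F f) (hφ : IsTest a b φ) :
    ∫ x in Ioo a b, F x * deriv φ x = -∫ x in Ioo a b, f x * φ x := by
  rcases le_or_gt b a with hab | hab
  · simp [Ioo_eq_empty (not_lt.2 hab)]
  obtain ⟨α, hα, β, hβ, h1, h2, hs⟩ := hφ.exists_tsupport_subset (x₀ := (a + b) / 2)
    ⟨by linarith, by linarith⟩
  have hαβ : α ≤ β := by linarith
  have hs' : tsupport (deriv φ) ⊆ Ioo α β :=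
    (closure_minimal (support_deriv_subset) (isClosed_tsupport φ)).trans hs
  rw [setIntegral_Ioo_eq_of_forall_notMem_eq_zero hα.1.le hβ.2.le hαβ (fun x hx => by
      rw [eq_zero_of_tsupport_subset hs' hx, mul_zero]),
    setIntegral_Ioo_eq_of_forall_notMem_eq_zero hα.1.le hβ.2.le hαβ (fun x hx => by
      rw [eq_zero_of_tsupport_subset hs hx, mul_zero])]
  have hP := hF α hα β hβ
  have hφP := hφ.isPrimitive α β
  have hprod := (hP.mul hαβ hφP).eq β ⟨hαβ, le_rfl⟩
  rw [eq_zero_of_tsupport_subset hs (fun h => lt_irrefl _ h.1),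
    eq_zero_of_tsupport_subset hs (fun h => lt_irrefl _ h.2),
    intervalIntegral.integral_add
      (hP.integrable.mul_continuousOn hφ.continuous.continuousOn)
      (hφP.integrable.continuousOn_mul (by rw [uIcc_of_le hαβ]; exact hP.continuousOn))] at hprod
  linarith

theorem isPrimitive_integral {x₀ c d : ℝ} (hu : LocallyIntegrableOn u (Ioo a b))
    (hx₀ : x₀ ∈ Ioo a b) (hc : c ∈ Ioo a b) (hd : d ∈ Ioo a b) :
    IsPrimitive c d (fun x => ∫ t in x₀..x, u t) u := by
  refine ⟨intervalIntegrable_of_locallyIntegrableOn hu hc hd, fun x hx => ?_⟩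
  rw [intervalIntegral.integral_add_adjacent_intervals
    (intervalIntegrable_of_locallyIntegrableOn hu hx₀ hc)
    (intervalIntegrable_of_locallyIntegrableOn hu hc ⟨hc.1.trans_le hx.1, hx.2.trans_lt hd.2⟩)]

theorem exists_isTest_integral_eq_one (hab : a < b) :
    ∃ η, IsTest a b η ∧ ∫ x in Ioo a b, η x = 1 := by
  let B : ContDiffBump ((a + b) / 2) := ⟨(b - a) / 8, (b - a) / 4, by linarith, by linarith⟩
  have hs : tsupport (B.normed volume) ⊆ Ioo a b := by
    rw [B.tsupport_normed_eq]
    intro y hy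
    rw [Metric.mem_closedBall, Real.dist_eq, abs_le] at hy
    have h3 : B.rOut = (b - a) / 4 := rfl
    rw [h3] at hy
    constructor <;> linarith [hy.1, hy.2]
  refine ⟨B.normed volume, ⟨B.contDiff_normed, B.hasCompactSupport_normed, hs⟩, ?_⟩
  rw [setIntegral_eq_integral_of_forall_compl_eq_zero
    (fun x hx => eq_zero_of_tsupport_subset hs hx)]
  exact B.integral_normed

/-- Test functions with vanishing mean are derivatives of test functions. -/
theorem IsTest.exists_deriv_eq (hψ : IsTest a b ψ) (h0 : ∫ x in Ioo a b, ψ x = 0) :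
    ∃ φ, IsTest a b φ ∧ ∀ x, _root_.deriv φ x = ψ x := by
  rcases le_or_gt b a with hab | hab
  · refine ⟨ψ, hψ, fun x => ?_⟩
    have h1 : ψ = fun _ => 0 := by
      funext y
      exact eq_zero_of_tsupport_subset hψ.2.2 (by simp [Ioo_eq_empty (not_lt.2 hab)])
    simp [h1]
  obtain ⟨α, hα, β, hβ, h1, h2, hs⟩ := hψ.exists_tsupport_subset (x₀ := (a + b) / 2)
    ⟨by linarith, by linarith⟩
  have hαβ : α ≤ β := by linarith
  rw [setIntegral_Ioo_eq_of_forall_notMem_eq_zero hα.1.le hβ.2.le hαβ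
    (fun x hx => eq_zero_of_tsupport_subset hs hx)] at h0
  have hi : ∀ c d, IntervalIntegrable ψ volume c d := fun c d =>
    hψ.continuous.intervalIntegrable c d
  have hd : ∀ x, HasDerivAt (fun x => ∫ t in α..x, ψ t) (ψ x) x := fun x =>
    intervalIntegral.integral_hasDerivAt_right (hi _ _)
      (hψ.continuous.stronglyMeasurableAtFilter _ _) hψ.continuous.continuousAt
  have hd' : _root_.deriv (fun x => ∫ t in α..x, ψ t) = ψ := funext fun x => (hd x).deriv
  have hz : ∀ x ∉ Icc α β, ∫ t in α..x, ψ t = 0 := by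
    intro x hx
    have hzero : ∀ c d, (∀ t ∈ uIcc c d, t ∉ Ioo α β) → ∫ t in c..d, ψ t = 0 := by
      intro c d hcd
      rw [intervalIntegral.integral_congr (g := fun _ => (0 : ℝ))
        (fun t ht => eq_zero_of_tsupport_subset hs (hcd t ht))]
      simp
    rcases lt_or_ge x α with hxα | hxα
    · refine hzero _ _ (fun t ht h => ?_)
      rw [uIcc_of_ge hxα.le] at ht
      exact absurd h.1 (not_lt.2 ht.2)
    · have hxβ : β < x := by
        by_contra hcon
        exact hx ⟨hxα, not_lt.1 hcon⟩
      rw [← intervalIntegral.integral_add_adjacent_intervals (hi α β) (hi β x), h0, zero_add]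
      refine hzero _ _ (fun t ht h => ?_)
      rw [uIcc_of_le hxβ.le] at ht
      exact absurd h.2 (not_lt.2 ht.1)
  refine ⟨fun x => ∫ t in α..x, ψ t, ⟨?_,
    HasCompactSupport.intro isCompact_Icc (fun x hx => hz x hx), ?_⟩, fun x => (hd x).deriv⟩
  · rw [contDiff_infty_iff_deriv, hd']
    exact ⟨fun x => (hd x).differentiableAt, hψ.1⟩
  · refine (closure_minimal (fun x hx => ?_) isClosed_Icc).trans (Icc_subset_Ioo hα.1 hβ.2)
    by_contra hcon
    exact hx (hz x hcon)

/-- The fundamental lemma of the calculus of variations. -/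
theorem ae_eq_zero_of_integral_mul_test_eq_zero (hu : LocallyIntegrableOn u (Ioo a b))
    (h : ∀ φ, IsTest a b φ → ∫ x in Ioo a b, u x * φ x = 0) :
    ∀ᵐ x ∂(volume.restrict (Ioo a b)), u x = 0 := by
  rw [ae_restrict_iff' measurableSet_Ioo]
  refine isOpen_Ioo.ae_eq_zero_of_integral_contDiff_smul_eq_zero hu (fun ψ h1 h2 h3 => ?_)
  rw [← h ψ ⟨h1, h2, h3⟩, setIntegral_eq_integral_of_forall_compl_eq_zero (fun x hx => by
    rw [eq_zero_of_tsupport_subset h3 hx, mul_zero])]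
  congr 1; funext x; simp [mul_comm]

/-- The du Bois-Reymond lemma. -/
theorem ae_eq_const_of_integral_mul_deriv_test_eq_zero (hu : LocallyIntegrableOn u (Ioo a b))
    (h : ∀ φ, IsTest a b φ → ∫ x in Ioo a b, u x * deriv φ x = 0) :
    ∃ c, ∀ᵐ x ∂(volume.restrict (Ioo a b)), u x = c := by
  rcases le_or_gt b a with hab | hab
  · exact ⟨0, by simp [Ioo_eq_empty (not_lt.2 hab)]⟩
  obtain ⟨η, hη, hη1⟩ := exists_isTest_integral_eq_one hab
  have hone : LocallyIntegrableOn (fun _ : ℝ => (1 : ℝ)) (Ioo a b) :=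
    (locallyIntegrable_const 1).locallyIntegrableOn _
  have hti : ∀ {ψ}, IsTest a b ψ → IntegrableOn ψ (Ioo a b) := fun {ψ} hψ => by
    simpa using integrableOn_mul_test hone hψ
  set C := ∫ x in Ioo a b, u x * η x with hC
  refine ⟨C, ?_⟩
  have key : ∀ ψ, IsTest a b ψ → ∫ x in Ioo a b, (u x - C) * ψ x = 0 := by
    intro ψ hψ
    set m := ∫ x in Ioo a b, ψ x with hm
    have hdiff : IsTest a b (fun x => ψ x - m * η x) := by
      refine ⟨hψ.1.sub (contDiff_const.mul hη.1), hψ.2.1.sub (hη.2.1.mul_left), ?_⟩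
      refine (tsupport_sub ψ (fun x => m * η x)).trans (union_subset hψ.2.2 ?_)
      exact (tsupport_mul_subset_right (f := fun _ => m) (g := η)).trans hη.2.2
    obtain ⟨φ, hφ, hφ'⟩ := hdiff.exists_deriv_eq (by
      rw [integral_sub (hti hψ) ((hti hη).const_mul m), integral_const_mul, hη1, ← hm]; ring)
    have h0 := h φ hφ
    simp only [hφ'] at h0
    have e1 : ∫ x in Ioo a b, u x * (ψ x - m * η x)
        = (∫ x in Ioo a b, u x * ψ x) - m * C := by
      rw [hC, ← integral_const_mul, ← integral_sub (integrableOn_mul_test hu hψ)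
        ((integrableOn_mul_test hu hη).const_mul m)]
      congr 1; funext x; ring
    have e2 : ∫ x in Ioo a b, (u x - C) * ψ x
        = (∫ x in Ioo a b, u x * ψ x) - C * m := by
      rw [hm, ← integral_const_mul, ← integral_sub (integrableOn_mul_test hu hψ)
        ((hti hψ).const_mul C)]
      congr 1; funext x; ring
    rw [e2]; linarith
  have hloc : LocallyIntegrableOn (fun x => u x - C) (Ioo a b) :=
    hu.sub ((locallyIntegrable_const C).locallyIntegrableOn _)
  filter_upwards [ae_eq_zero_of_integral_mul_test_eq_zero hloc key] with x hx
  linarith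

/-- A function with a weak derivative agrees almost everywhere with an indefinite integral of it. -/
theorem HasWeakDeriv.ae_eq_const_add_integral (h : HasWeakDeriv a b 1 u g) {x₀ : ℝ}
    (hx₀ : x₀ ∈ Ioo a b) :
    ∃ c, ∀ᵐ x ∂(volume.restrict (Ioo a b)), u x = c + ∫ t in x₀..x, g t := by
  have hP : ∀ c ∈ Ioo a b, ∀ d ∈ Ioo a b, IsPrimitive c d (fun x => ∫ t in x₀..x, g t) g :=
    fun c hc d hd => isPrimitive_integral h.2.1 hx₀ hc hd
  have hcont : ContinuousOn (fun x => ∫ t in x₀..x, g t) (Ioo a b) := by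
    intro x hx
    obtain ⟨c, hc⟩ := exists_between hx.1
    obtain ⟨d, hd⟩ := exists_between hx.2
    exact ((hP c ⟨hc.1, hc.2.trans hx.2⟩ d ⟨hx.1.trans hd.1, hd.2⟩).continuousOn.continuousAt
      (Icc_mem_nhds hc.2 hd.1)).continuousWithinAt
  have hU : LocallyIntegrableOn (fun x => ∫ t in x₀..x, g t) (Ioo a b) :=
    hcont.locallyIntegrableOn measurableSet_Ioo
  obtain ⟨c, hc⟩ := ae_eq_const_of_integral_mul_deriv_test_eq_zero
    (u := fun x => u x - ∫ t in x₀..x, g t) (h.1.sub hU) (fun φ hφ => by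
      have h1 := h.2.2 φ hφ
      rw [iteratedDeriv_one, pow_one] at h1
      have h2 := integral_mul_deriv_test hP hφ
      have : ∀ x, (u x - ∫ t in x₀..x, g t) * deriv φ x
          = u x * deriv φ x - (∫ t in x₀..x, g t) * deriv φ x := fun x => by ring
      simp only [this]
      rw [integral_sub (integrableOn_mul_test h.1 hφ.deriv) (integrableOn_mul_test hU hφ.deriv),
        h1, h2]
      ring)
  refine ⟨c, ?_⟩
  filter_upwards [hc] with x hx
  linarith

end FVE

/-! ### Weak derivatives, and positivity of the lower-order terms -/

namespace FVE

variable {a b : ℝ} {φ ψ u v g : ℝ → ℝ} {j m : ℕ}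

theorem HasWeakDeriv.ae_unique {g₁ g₂ : ℝ → ℝ} (h₁ : HasWeakDeriv a b j u g₁)
    (h₂ : HasWeakDeriv a b j u g₂) : ∀ᵐ x ∂(volume.restrict (Ioo a b)), g₁ x = g₂ x := by
  have := ae_eq_zero_of_integral_mul_test_eq_zero (u := fun x => g₁ x - g₂ x)
    (h₁.2.1.sub h₂.2.1) (fun φ hφ => by
      simp only [sub_mul]
      rw [integral_sub (integrableOn_mul_test h₁.2.1 hφ) (integrableOn_mul_test h₂.2.1 hφ)]
      have e := (h₁.2.2 φ hφ).symm.trans (h₂.2.2 φ hφ)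
      have hne : ((-1 : ℝ)) ^ j ≠ 0 := pow_ne_zero _ (by norm_num)
      rw [mul_left_cancel₀ hne e, sub_self])
  filter_upwards [this] with x hx
  linarith

theorem HasWeakDeriv.succ (h₁ : HasWeakDeriv a b j u v) (h₂ : HasWeakDeriv a b (j + 1) u g) :
    HasWeakDeriv a b 1 v g := by
  refine ⟨h₁.2.1, h₂.2.1, fun φ hφ => ?_⟩
  have e1 := h₁.2.2 _ hφ.deriv
  have e2 := h₂.2.2 _ hφ
  rw [iteratedDeriv_succ'] at e2
  rw [e2, pow_succ, mul_assoc] at e1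
  have hne : ((-1 : ℝ)) ^ j ≠ 0 := pow_ne_zero _ (by norm_num)
  rw [iteratedDeriv_one, pow_one, mul_left_cancel₀ hne e1]

theorem HasWeakDeriv.mono {c d : ℝ} (h : HasWeakDeriv a b j u g) (hc : a ≤ c) (hd : d ≤ b) :
    HasWeakDeriv c d j u g := by
  have hs : Ioo c d ⊆ Ioo a b := Ioo_subset_Ioo hc hd
  refine ⟨h.1.mono_set hs, h.2.1.mono_set hs, fun φ hφ => ?_⟩
  have e := h.2.2 φ (hφ.mono hc hd)
  have hz : ∀ {w : ℝ → ℝ}, (tsupport w ⊆ Ioo c d) → ∀ f : ℝ → ℝ,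
      ∫ x in Ioo a b, f x * w x = ∫ x in Ioo c d, f x * w x := fun hw f =>
    setIntegral_eq_of_subset_of_forall_sdiff_eq_zero measurableSet_Ioo hs
      (fun x hx => by rw [eq_zero_of_tsupport_subset hw hx.2, mul_zero])
  have hit : ∀ (n : ℕ) {w : ℝ → ℝ}, IsTest c d w → tsupport (iteratedDeriv n w) ⊆ Ioo c d := by
    intro n
    induction n with
    | zero => intro w hw; simpa using hw.2.2
    | succ n ih => intro w hw; rw [iteratedDeriv_succ']; exact ih hw.deriv
  rwa [hz (hit j hφ), hz hφ.2.2] at e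

theorem HasWeakDeriv.hasWeakDeriv_weakDeriv (h : HasWeakDeriv a b j u g) :
    HasWeakDeriv a b j u (weakDeriv a b j u) := by
  have hex : ∃ g, HasWeakDeriv a b j u g := ⟨g, h⟩
  rw [FVE.weakDeriv, dif_pos hex]
  exact hex.choose_spec

theorem HasWeakDeriv.weakDeriv_ae_eq (h : HasWeakDeriv a b j u g) :
    ∀ᵐ x ∂(volume.restrict (Ioo a b)), weakDeriv a b j u x = g x :=
  h.hasWeakDeriv_weakDeriv.ae_unique h

theorem HasWeakDeriv.seminormSq_eq (h : HasWeakDeriv a b j u g) :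
    seminormSq a b j u = ∫ x in Ioo a b, g x ^ 2 := by
  refine integral_congr_ae ?_
  filter_upwards [h.weakDeriv_ae_eq] with x hx
  rw [hx]

theorem MemSobolev.hasWeakDeriv (h : MemSobolev a b m u) (hj : j ≤ m) :
    HasWeakDeriv a b j u (weakDeriv a b j u) :=
  (h j hj).choose_spec.1.hasWeakDeriv_weakDeriv

theorem MemSobolev.memLp (h : MemSobolev a b m u) (hj : j ≤ m) :
    MemLp (weakDeriv a b j u) 2 (volume.restrict (Ioo a b)) := by
  obtain ⟨g, hg, hg2⟩ := h j hj
  exact (memLp_congr_ae hg.weakDeriv_ae_eq).2 hg2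

theorem _root_.MeasureTheory.MemLp.intervalIntegrable_of_le {f : ℝ → ℝ} (hab : a ≤ b)
    (h : MemLp f 2 (volume.restrict (Ioo a b))) : IntervalIntegrable f volume a b :=
  (intervalIntegrable_iff_integrableOn_Ioo_of_le hab).2 (h.integrable one_le_two)

theorem IsPrimitive.hasWeakDeriv {F f : ℝ → ℝ} (hab : a ≤ b) (h : IsPrimitive a b F f) :
    HasWeakDeriv a b 1 F f := by
  refine ⟨(h.continuousOn.mono Ioo_subset_Icc_self).locallyIntegrableOn measurableSet_Ioo,
    ((intervalIntegrable_iff_integrableOn_Ioo_of_le hab).1 h.integrable).locallyIntegrableOn,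
    fun φ hφ => ?_⟩
  rw [iteratedDeriv_one, integral_mul_deriv_test (fun c hc d hd =>
    h.mono (Ioo_subset_Icc_self hc) (Ioo_subset_Icc_self hd)) hφ]
  ring

/-- The absolutely continuous representative of a function with integrable weak derivative. -/
theorem HasWeakDeriv.exists_isPrimitive (h : HasWeakDeriv a b 1 u g) (hab : a < b)
    (hg : IntervalIntegrable g volume a b) :
    ∃ v, IsPrimitive a b v g ∧ ∀ᵐ x ∂(volume.restrict (Ioo a b)), u x = v x := by
  obtain ⟨x₀, hx₀⟩ := exists_between hab
  obtain ⟨c, hc⟩ := h.ae_eq_const_add_integral hx₀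
  have hi : ∀ {y z}, y ∈ Icc a b → z ∈ Icc a b → IntervalIntegrable g volume y z :=
    fun hy hz => hg.mono_set (by rw [uIcc_of_le hab.le]; exact uIcc_subset_Icc hy hz)
  have ha : a ∈ Icc a b := ⟨le_rfl, hab.le⟩
  have hx₀' : x₀ ∈ Icc a b := ⟨hx₀.1.le, hx₀.2.le⟩
  refine ⟨fun x => c + ∫ t in x₀..x, g t, ⟨hg, fun x hx => ?_⟩, hc⟩
  rw [add_assoc, intervalIntegral.integral_add_adjacent_intervals (hi hx₀' ha) (hi ha hx)]

theorem HasWeakDeriv.isPrimitive (h : HasWeakDeriv a b 1 u g) (hab : a < b)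
    (hg : IntervalIntegrable g volume a b) (hu : ContinuousOn u (Icc a b)) :
    IsPrimitive a b u g := by
  obtain ⟨v, hv, huv⟩ := h.exists_isPrimitive hab hg
  have h1 : EqOn u v (Ioo a b) := Measure.eqOn_Ioo_of_ae_eq (μ := volume) huv
    (hu.mono Ioo_subset_Icc_self) (hv.continuousOn.mono Ioo_subset_Icc_self)
  have h2 : EqOn u v (Icc a b) := h1.of_subset_closure hu hv.continuousOn Ioo_subset_Icc_self
    (by rw [closure_Ioo hab.ne])
  refine ⟨hg, fun x hx => ?_⟩
  rw [h2 hx, h2 ⟨le_rfl, hab.le⟩, hv.eq x hx]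

theorem IsPrimitive.trans {F f : ℝ → ℝ} {c : ℝ} (hab : a ≤ b) (h₁ : IsPrimitive a b F f)
    (h₂ : IsPrimitive b c F f) : IsPrimitive a c F f := by
  refine ⟨h₁.integrable.trans h₂.integrable, fun x hx => ?_⟩
  rcases le_total x b with hxb | hxb
  · exact h₁.eq x ⟨hx.1, hxb⟩
  · have hbc : b ≤ c := hxb.trans hx.2
    rw [h₂.eq x ⟨hxb, hx.2⟩, h₁.eq b ⟨hab, le_rfl⟩, add_assoc,
      intervalIntegral.integral_add_adjacent_intervals h₁.integrable
        (h₂.integrable_sub ⟨le_rfl, hbc⟩ ⟨hxb, hx.2⟩)]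

theorem IsPrimitive.congr_left {F G f : ℝ → ℝ} (h : IsPrimitive a b F f)
    (hFG : EqOn G F (Icc a b)) : IsPrimitive a b G f := by
  refine ⟨h.integrable, fun x hx => ?_⟩
  rw [hFG hx, hFG ⟨le_rfl, hx.1.trans hx.2⟩, h.eq x hx]

theorem ae_abs_le_of_memLp_top {f : ℝ → ℝ} {μ : Measure ℝ} (h : MemLp f ⊤ μ) :
    ∃ M, 0 < M ∧ ∀ᵐ x ∂μ, |f x| ≤ M := by
  refine ⟨(eLpNormEssSup f μ).toReal + 1, by positivity, ?_⟩
  have htop : eLpNormEssSup f μ ≠ ⊤ := by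
    rw [← eLpNorm_exponent_top]; exact h.2.ne
  filter_upwards [enorm_ae_le_eLpNormEssSup f μ] with x hx
  have := (ENNReal.toReal_le_toReal (by simp) htop).2 hx
  rw [toReal_enorm, Real.norm_eq_abs] at this
  linarith

/-- A continuous function that is bounded almost everywhere is bounded. -/
theorem abs_le_of_ae_abs_le {f : ℝ → ℝ} {M : ℝ} (hf : ContinuousOn f (Ioo a b))
    (h : ∀ᵐ x ∂(volume.restrict (Ioo a b)), |f x| ≤ M) : ∀ x ∈ Ioo a b, |f x| ≤ M := by
  have h1 : EqOn (fun x => max |f x| M) (fun _ => M) (Ioo a b) :=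
    Measure.eqOn_Ioo_of_ae_eq (μ := volume) (by
      filter_upwards [h] with x hx
      exact max_eq_right hx) (hf.abs.sup continuousOn_const) continuousOn_const
  intro x hx
  exact max_eq_right_iff.1 (h1 hx)

/-- Integrability of a product with an essentially bounded function. -/
theorem _root_.IntervalIntegrable.bdd_mul_of_ae {f w : ℝ → ℝ} {M : ℝ} (hab : a ≤ b)
    (hw : IntervalIntegrable w volume a b)
    (hf : AEStronglyMeasurable f (volume.restrict (Ioo a b)))
    (h : ∀ᵐ x ∂(volume.restrict (Ioo a b)), |f x| ≤ M) :
    IntervalIntegrable (fun x => f x * w x) volume a b := by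
  rw [intervalIntegrable_iff_integrableOn_Ioo_of_le hab] at hw ⊢
  exact hw.bdd_mul hf (c := M) (by simpa [Real.norm_eq_abs] using h)

/-- Positivity of the lower-order part of the bilinear form: integrating by parts moves the
derivative onto `q`, which leaves `(r - q' / 2) e²`. As `q'` is only locally integrable, this is
done on `[δ, 1 - δ]`, where the boundary terms are at most `M e² / 2`. -/
theorem integral_lowerOrder_nonneg {q q' r e d : ℝ → ℝ} {M : ℝ}
    (hqm : AEStronglyMeasurable q (volume.restrict (Ioo 0 1)))
    (hrm : AEStronglyMeasurable r (volume.restrict (Ioo 0 1)))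
    (hqM : ∀ᵐ x ∂(volume.restrict (Ioo (0 : ℝ) 1)), |q x| ≤ M)
    (hrM : ∀ᵐ x ∂(volume.restrict (Ioo (0 : ℝ) 1)), |r x| ≤ M)
    (hq' : HasWeakDeriv 0 1 1 q q')
    (hr : ∀ᵐ x ∂(volume.restrict (Ioo (0 : ℝ) 1)), 0 ≤ r x - q' x / 2)
    (he : IsPrimitive 0 1 e d) (he0 : e 0 = 0) (he1 : e 1 = 0) :
    0 ≤ ∫ x in (0 : ℝ)..1, (q x * (d x * e x) + r x * (e x * e x)) := by
  have h01 : (0 : ℝ) ≤ 1 := zero_le_one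
  have hM : 0 ≤ M := by
    have : (volume.restrict (Ioo (0 : ℝ) 1)) ≠ 0 := by
      simp [Measure.restrict_eq_zero]
    have := ae_neBot.2 this
    obtain ⟨x, hx⟩ := hqM.exists
    exact (abs_nonneg _).trans hx
  have hu01 : uIcc (0 : ℝ) 1 = Icc 0 1 := uIcc_of_le h01
  have hec : ContinuousOn e (Icc 0 1) := he.continuousOn
  set G : ℝ → ℝ := fun x => q x * (d x * e x) + r x * (e x * e x) with hG
  have hGi : IntervalIntegrable G volume 0 1 := by
    refine IntervalIntegrable.add ?_ ?_
    · exact (he.integrable.mul_continuousOn (hu01 ▸ hec)).bdd_mul_of_ae h01 hqm hqM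
    · refine IntervalIntegrable.bdd_mul_of_ae h01 ?_ hrm hrM
      exact ((hec.mul hec).mono hu01.subset).intervalIntegrable
  obtain ⟨c, hc⟩ := hq'.ae_eq_const_add_integral (x₀ := 1 / 2) ⟨by norm_num, by norm_num⟩
  set Q : ℝ → ℝ := fun x => c + ∫ t in (1 / 2 : ℝ)..x, q' t with hQ
  have hQP : ∀ α ∈ Ioo (0 : ℝ) 1, ∀ β ∈ Ioo (0 : ℝ) 1, IsPrimitive α β Q q' := by
    intro α hα β hβ
    have := isPrimitive_integral hq'.2.1 (x₀ := 1 / 2) ⟨by norm_num, by norm_num⟩ hα hβ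
    refine ⟨this.integrable, fun x hx => ?_⟩
    rw [hQ]
    simp only
    rw [this.eq x hx]; ring
  have hQc : ContinuousOn Q (Ioo 0 1) := by
    intro x hx
    obtain ⟨α, hα⟩ := exists_between hx.1
    obtain ⟨β, hβ⟩ := exists_between hx.2
    exact ((hQP α ⟨hα.1, hα.2.trans hx.2⟩ β ⟨hx.1.trans hβ.1, hβ.2⟩).continuousOn.continuousAt
      (Icc_mem_nhds hα.2 hβ.1)).continuousWithinAt
  have hQM : ∀ x ∈ Ioo (0 : ℝ) 1, |Q x| ≤ M := abs_le_of_ae_abs_le hQc (by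
    filter_upwards [hqM, hc] with x h1 h2
    have h2' : q x = Q x := h2
    rwa [← h2'])
  set X : ℝ → ℝ := fun x => ∫ t in (0 : ℝ)..x, G t with hX
  have hXP : IsPrimitive 0 1 X G := ⟨hGi, fun x _ => by simp [hX]⟩
  have key : ∀ δ ∈ Ioo (0 : ℝ) (1 / 2),
      0 ≤ X (1 - δ) - X δ + M / 2 * (e δ * e δ + e (1 - δ) * e (1 - δ)) := by
    intro δ hδ
    have hδ1 : δ ∈ Ioo (0 : ℝ) 1 := ⟨hδ.1, by linarith [hδ.2]⟩
    have hδ2 : 1 - δ ∈ Ioo (0 : ℝ) 1 := ⟨by linarith [hδ.2], by linarith [hδ.1]⟩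
    have hle : δ ≤ 1 - δ := by linarith [hδ.2]
    have hPe := he.mono (Ioo_subset_Icc_self hδ1) (Ioo_subset_Icc_self hδ2)
    have hprod := (hQP δ hδ1 _ hδ2).mul hle (hPe.mul hle hPe)
    have h1 := hprod.sub_eq ⟨le_rfl, hle⟩ ⟨hle, le_rfl⟩
    have h2 : (1 / 2) * ∫ x in δ..(1 - δ), (q' x * (e x * e x) + Q x * (d x * e x + e x * d x))
        ≤ ∫ x in δ..(1 - δ), G x := by
      rw [← intervalIntegral.integral_const_mul]
      refine intervalIntegral.integral_mono_ae_restrict hle (hprod.integrable.const_mul _)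
        (hXP.integrable_sub (Ioo_subset_Icc_self hδ1) (Ioo_subset_Icc_self hδ2)) ?_
      have hss : Icc δ (1 - δ) ⊆ Ioo 0 1 := Icc_subset_Ioo hδ1.1 hδ2.2
      filter_upwards [ae_restrict_of_ae_restrict_of_subset hss hc,
        ae_restrict_of_ae_restrict_of_subset hss hr] with x hx1 hx2
      have hx1' : q x = Q x := hx1
      simp only [hG]
      rw [hx1']
      nlinarith [mul_nonneg hx2 (mul_self_nonneg (e x))]
    rw [← h1, ← hXP.sub_eq (Ioo_subset_Icc_self hδ1) (Ioo_subset_Icc_self hδ2)] at h2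
    have h3 := abs_le.1 (hQM _ hδ1)
    have h4 := abs_le.1 (hQM _ hδ2)
    nlinarith [mul_le_mul_of_nonneg_right h3.2 (mul_self_nonneg (e δ)),
      mul_le_mul_of_nonneg_right h4.1 (mul_self_nonneg (e (1 - δ)))]
  have hcont : ContinuousOn
      (fun δ => X (1 - δ) - X δ + M / 2 * (e δ * e δ + e (1 - δ) * e (1 - δ))) (Icc 0 1) := by
    have hm : MapsTo (fun δ : ℝ => 1 - δ) (Icc 0 1) (Icc 0 1) := fun x hx =>
      ⟨by linarith [hx.2], by linarith [hx.1]⟩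
    have h1 : ContinuousOn (fun δ : ℝ => 1 - δ) (Icc 0 1) := by fun_prop
    have hX1 := hXP.continuousOn.comp h1 hm
    have he1 := hec.comp h1 hm
    exact (hX1.sub hXP.continuousOn).add
      (continuousOn_const.mul ((hec.mul hec).add (he1.mul he1)))
  have hlim := (hcont 0 ⟨le_rfl, h01⟩).mono
    (show Ioo (0 : ℝ) (1 / 2) ⊆ Icc 0 1 from fun x hx => ⟨hx.1.le, by linarith [hx.2]⟩)
  have : (nhdsWithin (0 : ℝ) (Ioo 0 (1 / 2))).NeBot := by
    rw [← mem_closure_iff_nhdsWithin_neBot, closure_Ioo (by norm_num)]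
    exact ⟨le_rfl, by norm_num⟩
  have h0 := ge_of_tendsto hlim (b := 0) (eventually_mem_nhdsWithin.mono (fun δ hδ => key δ hδ))
  simpa [hX, he0, he1] using h0

end FVE

/-! ### Polynomial approximation and Lagrange interpolation -/

namespace FVE

/-- The Cauchy–Schwarz inequality against the constant function `1`. -/
theorem sq_integral_abs_le {a b : ℝ} {f : ℝ → ℝ} (hab : a ≤ b)
    (hf : IntervalIntegrable f volume a b)
    (hf2 : IntervalIntegrable (fun x => f x ^ 2) volume a b) :
    (∫ x in a..b, |f x|) ^ 2 ≤ (b - a) * ∫ x in a..b, f x ^ 2 := by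
  rcases hab.eq_or_lt with rfl | hab'
  · simp
  set I := ∫ x in a..b, |f x| with hI
  have hpos : 0 < b - a := sub_pos.2 hab'
  have h0 : 0 ≤ ∫ x in a..b, (f x ^ 2 - (2 * (I / (b - a))) * |f x| + (I / (b - a)) ^ 2) := by
    refine intervalIntegral.integral_nonneg hab (fun x _ => ?_)
    rw [← sq_abs (f x)]
    nlinarith [sq_nonneg (|f x| - I / (b - a))]
  rw [intervalIntegral.integral_add (hf2.sub (hf.abs.const_mul _)) (by simp),
    intervalIntegral.integral_sub hf2 (hf.abs.const_mul _), intervalIntegral.integral_const_mul,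
    intervalIntegral.integral_const, ← hI, smul_eq_mul] at h0
  have h1 : (b - a) * ((∫ x in a..b, f x ^ 2) - 2 * (I / (b - a)) * I + (b - a) * (I / (b - a)) ^ 2)
      = (b - a) * (∫ x in a..b, f x ^ 2) - I ^ 2 := by
    field_simp
    ring
  nlinarith [mul_nonneg hpos.le h0]

/-- Every real polynomial has a polynomial antiderivative. -/
theorem exists_derivative_eq (P : Polynomial ℝ) :
    ∃ Q : Polynomial ℝ, Q.natDegree ≤ P.natDegree + 1 ∧ Polynomial.derivative Q = P := by
  refine ⟨∑ i ∈ Finset.range (P.natDegree + 1),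
    Polynomial.monomial (i + 1) (P.coeff i / (i + 1)), ?_, ?_⟩
  · refine Polynomial.natDegree_sum_le_of_forall_le _ _ (fun i hi => ?_)
    exact (Polynomial.natDegree_monomial_le _).trans
      (Nat.succ_le_succ (Nat.lt_succ_iff.1 (Finset.mem_range.1 hi)))
  · rw [Polynomial.derivative_sum]
    conv_rhs => rw [P.as_sum_range]
    refine Finset.sum_congr rfl (fun i _ => ?_)
    rw [Polynomial.derivative_monomial]
    have : (i : ℝ) + 1 ≠ 0 := by positivity
    simp [div_mul_cancel₀ _ this]

theorem isPrimitive_polynomial (P : Polynomial ℝ) (a b : ℝ) :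
    IsPrimitive a b (fun x => P.eval x) (fun x => P.derivative.eval x) := by
  refine ⟨P.derivative.continuous.intervalIntegrable _ _, fun x _ => ?_⟩
  rw [intervalIntegral.integral_eq_sub_of_hasDerivAt (fun y _ => P.hasDerivAt y)
    (P.derivative.continuous.intervalIntegrable _ _)]
  ring

/-- A quantitative Taylor approximation in Sobolev spaces: if `D 0, D 1, …, D (m + 1)` are
successive weak derivatives, then `D 0` agrees almost everywhere with an absolutely continuous
function which is close to a polynomial of degree at most `m`. -/
theorem exists_polynomial_approx {a b : ℝ} (hab : a < b) (m : ℕ) :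
    ∀ D : ℕ → ℝ → ℝ, (∀ j ≤ m, HasWeakDeriv a b 1 (D j) (D (j + 1))) →
      (∀ j ≤ m + 1, MemLp (D j) 2 (volume.restrict (Ioo a b))) →
      ∃ v, IsPrimitive a b v (D 1) ∧ (∀ᵐ x ∂(volume.restrict (Ioo a b)), D 0 x = v x) ∧
        ∃ P : Polynomial ℝ, P.natDegree ≤ m ∧ ∀ x ∈ Icc a b,
          |v x - P.eval x| ≤ (b - a) ^ m * √((b - a) * ∫ y in Ioo a b, D (m + 1) y ^ 2) := by
  induction m with
  | zero =>
    intro D hD hL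
    obtain ⟨v, hv, hDv⟩ := (hD 0 le_rfl).exists_isPrimitive hab
      ((hL 1 le_rfl).intervalIntegrable_of_le hab.le)
    refine ⟨v, hv, hDv, Polynomial.C (v a), by simp, fun x hx => ?_⟩
    have hab' := hab.le
    have hi : IntervalIntegrable (fun x => D 1 x ^ 2) volume a b :=
      (intervalIntegrable_iff_integrableOn_Ioo_of_le hab').2 (hL 1 le_rfl).integrable_sq
    rw [Polynomial.eval_C, hv.sub_eq ⟨le_rfl, hab'⟩ hx, pow_zero, one_mul]
    refine Real.le_sqrt_of_sq_le ?_
    rw [← integral_Ioc_eq_integral_Ioo, ← intervalIntegral.integral_of_le hab', zero_add]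
    refine le_trans ?_ (sq_integral_abs_le hab' hv.integrable hi)
    refine pow_le_pow_left₀ (abs_nonneg _) ?_ 2
    refine (intervalIntegral.abs_integral_le_integral_abs hx.1).trans ?_
    exact intervalIntegral.integral_mono_interval le_rfl hx.1 hx.2
      (Filter.Eventually.of_forall fun _ => abs_nonneg _) hv.integrable.abs
  | succ m ih =>
    intro D hD hL
    obtain ⟨w, hw, hDw, P, hP, hPw⟩ := ih (fun j => D (j + 1))
      (fun j hj => hD (j + 1) (Nat.succ_le_succ hj)) (fun j hj => hL (j + 1) (Nat.succ_le_succ hj))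
    obtain ⟨v, hv, hDv⟩ := (hD 0 (Nat.zero_le _)).exists_isPrimitive hab
      ((hL 1 (by omega)).intervalIntegrable_of_le hab.le)
    obtain ⟨S, hS, hSP⟩ := exists_derivative_eq P
    refine ⟨v, hv, hDv, S + Polynomial.C (v a - S.eval a), ?_, fun x hx => ?_⟩
    · refine (Polynomial.natDegree_add_le _ _).trans ?_
      simp only [Polynomial.natDegree_C]
      omega
    have hvw : IsPrimitive a b v w := hv.congr_ae hab.le (by simpa using hDw)
    have hSp := isPrimitive_polynomial S a b
    rw [hSP] at hSp
    have hsub := (hvw.sub hSp).sub_eq ⟨le_rfl, hab.le⟩ hx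
    set B := (b - a) ^ m * √((b - a) * ∫ y in Ioo a b, D (m + 1 + 1) y ^ 2) with hB
    have hB0 : 0 ≤ B := mul_nonneg (pow_nonneg (sub_nonneg.2 hab.le) _) (Real.sqrt_nonneg _)
    have hbound : |∫ t in a..x, (w t - P.eval t)| ≤ B * |x - a| := by
      rw [← Real.norm_eq_abs]
      refine intervalIntegral.norm_integral_le_of_norm_le_const (fun t ht => ?_)
      rw [uIoc_of_le hx.1] at ht
      rw [Real.norm_eq_abs]
      exact hPw t ⟨ht.1.le, ht.2.trans hx.2⟩
    rw [abs_of_nonneg (sub_nonneg.2 hx.1)] at hbound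
    have e : v x - (S + Polynomial.C (v a - S.eval a)).eval x = ∫ t in a..x, (w t - P.eval t) := by
      rw [← hsub, Polynomial.eval_add, Polynomial.eval_C]; ring
    rw [e]
    refine hbound.trans ?_
    have e2 : (b - a) ^ (m + 1) * √((b - a) * ∫ y in Ioo a b, D (m + 1 + 1) y ^ 2)
        = B * (b - a) := by rw [hB]; ring
    rw [e2]
    exact mul_le_mul_of_nonneg_left (by linarith [hx.2]) hB0

/-- Lagrange interpolation at the points `G 1, …, G k` on the reference interval `[-1, 1]`. -/
theorem exists_lagrange_coeff (k : ℕ) (G : ℕ → ℝ) (hG : InjOn G (Finset.Icc 1 k)) :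
    ∃ (l : ℕ → ℝ → ℝ) (L : ℝ), 0 < L ∧ (∀ j ∈ Finset.Icc 1 k, ∀ t ∈ Icc (-1 : ℝ) 1, |l j t| ≤ L) ∧
      ∀ S : Polynomial ℝ, S.natDegree < k → ∀ t,
        S.eval t = ∑ j ∈ Finset.Icc 1 k, l j t * S.eval (G j) := by
  have hb : ∀ j : ℕ, ∃ B : ℝ, ∀ t ∈ Icc (-1 : ℝ) 1,
      |(Lagrange.basis (Finset.Icc 1 k) G j).eval t| ≤ B := fun j => by
    obtain ⟨B, hB⟩ := isCompact_Icc.exists_bound_of_continuousOn (s := Icc (-1 : ℝ) 1)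
      (Lagrange.basis (Finset.Icc 1 k) G j).continuous.continuousOn
    exact ⟨B, hB⟩
  choose B hB using hb
  refine ⟨fun j t => (Lagrange.basis (Finset.Icc 1 k) G j).eval t,
    1 + ∑ j ∈ Finset.Icc 1 k, |B j|, by positivity, fun j hj t ht => ?_, fun S hS t => ?_⟩
  · have h1 := Finset.single_le_sum (f := fun j => |B j|) (fun i _ => abs_nonneg _) hj
    have h2 := hB j t ht
    have h3 := le_abs_self (B j)
    linarith
  · have hdeg : S.degree < (Finset.Icc 1 k).card := by
      rw [Nat.card_Icc, Nat.add_sub_cancel]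
      exact Polynomial.degree_le_natDegree.trans_lt (by exact_mod_cast hS)
    conv_lhs => rw [Lagrange.eq_interpolate hG hdeg]
    rw [Lagrange.interpolate_apply, Polynomial.eval_finsetSum]
    refine Finset.sum_congr rfl (fun j _ => ?_)
    rw [Polynomial.eval_mul, Polynomial.eval_C, mul_comm]

/-- Lagrange interpolation transported to the interval `[a, b]`; the coefficients stay bounded
independently of the interval. -/
theorem lagrange_eval_affine {k : ℕ} {G : ℕ → ℝ} {l : ℕ → ℝ → ℝ}
    (hl : ∀ S : Polynomial ℝ, S.natDegree < k → ∀ t,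
        S.eval t = ∑ j ∈ Finset.Icc 1 k, l j t * S.eval (G j))
    {a b : ℝ} (hab : a < b) (S : Polynomial ℝ) (hS : S.natDegree < k) (x : ℝ) :
    S.eval x = ∑ j ∈ Finset.Icc 1 k,
      l j ((2 * x - a - b) / (b - a)) * S.eval ((b + a + (b - a) * G j) / 2) := by
  have hne : b - a ≠ 0 := (sub_pos.2 hab).ne'
  set A : Polynomial ℝ := Polynomial.C ((b - a) / 2) * Polynomial.X + Polynomial.C ((b + a) / 2)
  have hA : ∀ t, A.eval t = (b - a) / 2 * t + (b + a) / 2 := fun t => by simp [A]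
  have hdeg : (S.comp A).natDegree < k := by
    refine lt_of_le_of_lt ?_ hS
    rw [Polynomial.natDegree_comp]
    exact (Nat.mul_le_mul_left _ Polynomial.natDegree_linear_le).trans (by simp)
  have := hl (S.comp A) hdeg ((2 * x - a - b) / (b - a))
  simp only [Polynomial.eval_comp, hA] at this
  have e : (b - a) / 2 * ((2 * x - a - b) / (b - a)) + (b + a) / 2 = x := by
    field_simp; ring
  rw [e] at this
  rw [this]
  refine Finset.sum_congr rfl (fun j _ => ?_)
  congr 2; ring

end FVE

/-! ### Meshes and the oscillation of the diffusion coefficient -/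

namespace FVE

namespace Mesh

variable (T : Mesh)

theorem N_pos : 1 ≤ T.N := by
  have := T.nonempty_index
  rwa [Finset.nonempty_Icc] at this

theorem x_mono {i j : ℕ} (hij : i ≤ j) (hj : j ≤ T.N) : T.x i ≤ T.x j := by
  induction j, hij using Nat.le_induction with
  | base => exact le_rfl
  | succ j hij ih => exact (ih (by omega)).trans (T.x_lt j (by omega)).le

theorem x_mem {i : ℕ} (hi : i ≤ T.N) : T.x i ∈ Icc (0 : ℝ) 1 :=
  ⟨T.x_zero ▸ T.x_mono (Nat.zero_le i) hi, T.x_last ▸ T.x_mono hi le_rfl⟩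

variable {T} {i : ℕ}

theorem x_pred_lt (hi : i ∈ Finset.Icc 1 T.N) : T.x (i - 1) < T.x i := by
  rw [Finset.mem_Icc] at hi
  have := T.x_lt (i - 1) (by omega)
  rwa [Nat.sub_add_cancel hi.1] at this

theorem x_pred_mem (hi : i ∈ Finset.Icc 1 T.N) : T.x (i - 1) ∈ Icc (0 : ℝ) 1 :=
  T.x_mem (by rw [Finset.mem_Icc] at hi; omega)

theorem x_mem' (hi : i ∈ Finset.Icc 1 T.N) : T.x i ∈ Icc (0 : ℝ) 1 :=
  T.x_mem (Finset.mem_Icc.1 hi).2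

theorem len_pos (hi : i ∈ Finset.Icc 1 T.N) : 0 < T.len i := sub_pos.2 (x_pred_lt hi)

theorem len_le_h (hi : i ∈ Finset.Icc 1 T.N) : T.len i ≤ T.h := Finset.le_sup' T.len hi

theorem h_pos : 0 < T.h :=
  have h1 : 1 ∈ Finset.Icc 1 T.N := Finset.mem_Icc.2 ⟨le_rfl, T.N_pos⟩
  (len_pos h1).trans_le (len_le_h h1)

theorem Ioo_subset (hi : i ∈ Finset.Icc 1 T.N) : Ioo (T.x (i - 1)) (T.x i) ⊆ Ioo (0 : ℝ) 1 :=
  Ioo_subset_Ioo (x_pred_mem hi).1 (x_mem' hi).2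

theorem Icc_subset (hi : i ∈ Finset.Icc 1 T.N) : Icc (T.x (i - 1)) (T.x i) ⊆ Icc (0 : ℝ) 1 :=
  Icc_subset_Icc (x_pred_mem hi).1 (x_mem' hi).2

theorem node_mem (hi : i ∈ Finset.Icc 1 T.N) {t : ℝ} (ht : t ∈ Ioo (-1 : ℝ) 1) :
    (T.x i + T.x (i - 1) + T.len i * t) / 2 ∈ Ioo (T.x (i - 1)) (T.x i) := by
  have := len_pos hi
  have e : T.len i = T.x i - T.x (i - 1) := rfl
  constructor
  · nlinarith [mul_pos this (show 0 < 1 + t by linarith [ht.1])]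
  · nlinarith [mul_pos this (show 0 < 1 - t by linarith [ht.2])]

theorem sum_Icc_eq_sum_range (f : ℕ → ℕ → ℝ) (N : ℕ) :
    ∑ i ∈ Finset.Icc 1 N, f (i - 1) i = ∑ i ∈ Finset.range N, f i (i + 1) := by
  induction N with
  | zero => simp
  | succ N ih => rw [Finset.sum_Icc_succ_top (by omega), ih, Finset.sum_range_succ]; rfl

theorem sum_integral {f : ℝ → ℝ} (hf : IntervalIntegrable f volume 0 1) :
    ∑ i ∈ Finset.Icc 1 T.N, ∫ x in (T.x (i - 1))..(T.x i), f x = ∫ x in (0 : ℝ)..1, f x := by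
  rw [sum_Icc_eq_sum_range (fun i j => ∫ x in (T.x i)..(T.x j), f x),
    intervalIntegral.sum_integral_adjacent_intervals, T.x_zero, T.x_last]
  intro n hn
  refine hf.mono_set ?_
  rw [uIcc_of_le zero_le_one]
  exact uIcc_subset_Icc (T.x_mem (by omega)) (T.x_mem (by omega))

theorem sum_len : ∑ i ∈ Finset.Icc 1 T.N, T.len i = 1 := by
  have := sum_integral (T := T) (f := fun _ => 1) (by simp)
  simpa [len] using this

theorem exists_mem_Ioc {y : ℝ} (hy : y ∈ Ioc (0 : ℝ) 1) :
    ∃ i ∈ Finset.Icc 1 T.N, y ∈ Ioc (T.x (i - 1)) (T.x i) := by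
  have key : ∀ n ≤ T.N, y ≤ T.x n → ∃ i ∈ Finset.Icc 1 T.N, y ∈ Ioc (T.x (i - 1)) (T.x i) := by
    intro n
    induction n with
    | zero => intro _ h; rw [T.x_zero] at h; exact absurd hy.1 (not_lt.2 h)
    | succ n ih =>
      intro hn h
      rcases le_or_gt y (T.x n) with h' | h'
      · exact ih (by omega) h'
      · exact ⟨n + 1, Finset.mem_Icc.2 ⟨by omega, hn⟩, h', h⟩
  exact key T.N le_rfl (by rw [T.x_last]; exact hy.2)

theorem eq_of_mem_Ioc {i' : ℕ} {y : ℝ} (hi : i ∈ Finset.Icc 1 T.N) (hi' : i' ∈ Finset.Icc 1 T.N)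
    (hy : y ∈ Ioc (T.x (i - 1)) (T.x i)) (hy' : y ∈ Ioc (T.x (i' - 1)) (T.x i')) : i = i' := by
  rw [Finset.mem_Icc] at hi hi'
  rcases lt_trichotomy i i' with h | h | h
  · have := T.x_mono (show i ≤ i' - 1 by omega) (by omega)
    linarith [hy.2, hy'.1]
  · exact h
  · have := T.x_mono (show i' ≤ i - 1 by omega) (by omega)
    linarith [hy'.2, hy.1]

variable (T) in
theorem ae_exists_mem_Ioo : ∀ᵐ y ∂(volume.restrict (Ioc (0 : ℝ) 1)),
    ∃ i ∈ Finset.Icc 1 T.N, y ∈ Ioo (T.x (i - 1)) (T.x i) := by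
  have hnull : ∀ᵐ y : ℝ, y ∉ (Finset.image T.x (Finset.range (T.N + 1)) : Set ℝ) :=
    measure_eq_zero_iff_ae_notMem.1 ((Finset.finite_toSet _).measure_zero _)
  rw [ae_restrict_iff' measurableSet_Ioc]
  filter_upwards [hnull] with y hy hy01
  obtain ⟨i, hi, hyi⟩ := exists_mem_Ioc (T := T) hy01
  refine ⟨i, hi, hyi.1, lt_of_le_of_ne hyi.2 (fun h => hy ?_)⟩
  rw [h, Finset.mem_coe]
  exact Finset.mem_image_of_mem _ (Finset.mem_range.2 (by rw [Finset.mem_Icc] at hi; omega))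

/-- A coefficient that is continuous inside the elements of a mesh is continuous almost
everywhere. -/
theorem ae_continuousAt {p : ℝ → ℝ}
    (hp : ∀ i ∈ Finset.Icc 1 T.N, ContinuousOn p (Ioo (T.x (i - 1)) (T.x i))) :
    ∀ᵐ y ∂(volume.restrict (Ioc (0 : ℝ) 1)), ContinuousAt p y := by
  filter_upwards [ae_exists_mem_Ioo T] with y ⟨i, hi, hyi⟩
  exact (hp i hi).continuousAt (Ioo_mem_nhds hyi.1 hyi.2)

/-- The oscillation of `p` about its values at one node per element tends to `0` with the mesh
size, uniformly over all meshes inside whose elements `p` is continuous. -/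
theorem exists_oscillation_le {p : ℝ → ℝ} {M : ℝ}
    (hpm : AEStronglyMeasurable p (volume.restrict (Ioo (0 : ℝ) 1)))
    (hpM : ∀ᵐ x ∂(volume.restrict (Ioo (0 : ℝ) 1)), |p x| ≤ M)
    {t : ℝ} (ht : t ∈ Ioo (-1 : ℝ) 1) {ε : ℝ} (hε : 0 < ε) :
    ∃ h₀ : ℝ, 0 < h₀ ∧ ∀ T : Mesh, T.h ≤ h₀ →
      (∀ i ∈ Finset.Icc 1 T.N, ContinuousOn p (Ioo (T.x (i - 1)) (T.x i))) →
      ∑ i ∈ Finset.Icc 1 T.N, ∫ y in (T.x (i - 1))..(T.x i),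
        (p y - p ((T.x i + T.x (i - 1) + T.len i * t) / 2)) ^ 2 ≤ ε := by
  by_contra hcon
  push Not at hcon
  -- Otherwise there are meshes with sizes tending to zero on which the oscillation exceeds `ε`. The
  -- first of them shows that `p` is continuous almost everywhere.
  choose T hTh hTp hTε using fun n : ℕ => hcon (1 / ((n : ℝ) + 1)) (by positivity)
  rw [Measure.restrict_congr_set (Ioo_ae_eq_Ioc (μ := volume) (a := (0 : ℝ)) (b := 1))] at hpm
  -- `s n i` is the deviation on the element `K_i` of the `n`-th mesh, extended by zero.
  set y : ℕ → ℕ → ℝ := fun n i => ((T n).x i + (T n).x (i - 1) + (T n).len i * t) / 2 with hy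
  set s : ℕ → ℕ → ℝ → ℝ := fun n i =>
    (Ioc ((T n).x (i - 1)) ((T n).x i)).indicator (fun z => (p z - p (y n i)) ^ 2) with hs
  set F : ℕ → ℝ → ℝ := fun n z => ∑ i ∈ Finset.Icc 1 (T n).N, s n i z with hF
  have hbd : ∀ n, ∀ i ∈ Finset.Icc 1 (T n).N, |p (y n i)| ≤ M := fun n i hi =>
    abs_le_of_ae_abs_le (hTp n i hi) (ae_restrict_of_ae_restrict_of_subset (Ioo_subset hi) hpM)
      _ (node_mem hi ht)
  have hpM' : ∀ᵐ x ∂(volume.restrict (Ioc (0 : ℝ) 1)), |p x| ≤ M := by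
    rwa [← Measure.restrict_congr_set (Ioo_ae_eq_Ioc (μ := volume) (a := (0 : ℝ)) (b := 1))]
  have hFeq : ∀ n, ∀ z ∈ Ioc (0 : ℝ) 1, ∃ i ∈ Finset.Icc 1 (T n).N,
      z ∈ Ioc ((T n).x (i - 1)) ((T n).x i) ∧ F n z = (p z - p (y n i)) ^ 2 := by
    intro n z hz
    obtain ⟨i, hi, hzi⟩ := exists_mem_Ioc (T := T n) hz
    refine ⟨i, hi, hzi, ?_⟩
    simp only [hF]
    rw [Finset.sum_eq_single_of_mem i hi]
    · simp only [hs, indicator_of_mem hzi]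
    · intro i' hi' hne
      simp only [hs]
      rw [indicator_of_notMem (fun h => hne (eq_of_mem_Ioc hi' hi h hzi))]
  have hsm : ∀ n i, AEStronglyMeasurable (s n i) (volume.restrict (Ioc (0 : ℝ) 1)) := fun n i =>
    ((hpm.sub aestronglyMeasurable_const).pow 2).indicator measurableSet_Ioc
  have hsi : ∀ n, ∀ i ∈ Finset.Icc 1 (T n).N,
      Integrable (s n i) (volume.restrict (Ioc (0 : ℝ) 1)) := by
    intro n i hi
    refine Integrable.of_bound (hsm n i) ((2 * M) ^ 2) ?_
    filter_upwards [hpM'] with z hz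
    refine (norm_indicator_le_norm_self _ _).trans ?_
    rw [Real.norm_eq_abs, abs_pow]
    refine pow_le_pow_left₀ (abs_nonneg _) ?_ 2
    have := abs_sub (p z) (p (y n i))
    linarith [hbd n i hi]
  have hlim : Filter.Tendsto (fun n => ∫ z in Ioc (0 : ℝ) 1, F n z) Filter.atTop
      (nhds (∫ _ in Ioc (0 : ℝ) 1, (0 : ℝ))) := by
    refine tendsto_integral_of_dominated_convergence (fun _ => (2 * M) ^ 2) ?_
      (integrable_const _) ?_ ?_
    · intro n
      exact Finset.aestronglyMeasurable_fun_sum _ (fun i _ => hsm n i)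
    · intro n
      filter_upwards [hpM', ae_restrict_mem measurableSet_Ioc] with z hz hz01
      obtain ⟨i, hi, -, he⟩ := hFeq n z hz01
      rw [he, Real.norm_eq_abs, abs_pow]
      refine pow_le_pow_left₀ (abs_nonneg _) ?_ 2
      have := abs_sub (p z) (p (y n i))
      linarith [hbd n i hi]
    · filter_upwards [ae_continuousAt (hTp 0), ae_restrict_mem measurableSet_Ioc] with z hz hz01
      choose i hi hzi he using fun n => hFeq n z hz01
      simp only [he]
      have hyz : Filter.Tendsto (fun n => y n (i n)) Filter.atTop (nhds z) := by
        rw [tendsto_iff_dist_tendsto_zero]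
        refine squeeze_zero (fun _ => dist_nonneg) (fun n => ?_)
          (tendsto_one_div_add_atTop_nhds_zero_nat (𝕜 := ℝ))
        refine le_trans ?_ ((len_le_h (hi n)).trans (hTh n))
        have h1 := node_mem (hi n) ht
        have h2 := hzi n
        have e : (T n).len (i n) = (T n).x (i n) - (T n).x (i n - 1) := rfl
        rw [Real.dist_eq, abs_le, e]
        simp only [hy]
        constructor <;> linarith [h1.1, h1.2, h2.1, h2.2]
      have := ((tendsto_const_nhds (x := p z)).sub (hz.tendsto.comp hyz)).pow 2
      simpa using this
  have hval : ∀ n, ε < ∫ z in Ioc (0 : ℝ) 1, F n z := by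
    intro n
    refine (hTε n).trans_le (le_of_eq ?_)
    simp only [hF]
    rw [integral_finsetSum _ (hsi n)]
    refine Finset.sum_congr rfl (fun i hi => ?_)
    rw [intervalIntegral.integral_of_le (x_pred_lt hi).le]
    simp only [hs]
    rw [setIntegral_indicator measurableSet_Ioc,
      inter_eq_right.2 (Ioc_subset_Ioc (x_pred_mem hi).1 (x_mem' hi).2)]
  have := ge_of_tendsto' hlim (fun n => (hval n).le)
  simp at this
  linarith

end Mesh

end FVE

/-! ### Coercivity and bounds by the flux defect -/

namespace FVE

/-- Essentially bounded coefficients, with the leading one bounded below. -/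
structure IsBoundedCoeff (p q r : ℝ → ℝ) (M p₀ : ℝ) : Prop where
  M_pos : 0 < M
  p₀_pos : 0 < p₀
  p_meas : AEStronglyMeasurable p (volume.restrict (Ioo (0 : ℝ) 1))
  q_meas : AEStronglyMeasurable q (volume.restrict (Ioo (0 : ℝ) 1))
  r_meas : AEStronglyMeasurable r (volume.restrict (Ioo (0 : ℝ) 1))
  p_le : ∀ᵐ x ∂(volume.restrict (Ioo (0 : ℝ) 1)), |p x| ≤ M
  q_le : ∀ᵐ x ∂(volume.restrict (Ioo (0 : ℝ) 1)), |q x| ≤ M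
  r_le : ∀ᵐ x ∂(volume.restrict (Ioo (0 : ℝ) 1)), |r x| ≤ M
  le_p : ∀ᵐ x ∂(volume.restrict (Ioo (0 : ℝ) 1)), p₀ ≤ p x

/-- A function `e ∈ H_0^1(0, 1)` with derivative `d` on which the lower-order part of the bilinear
form is nonnegative. -/
structure IsAdmissible (q r e d : ℝ → ℝ) : Prop where
  prim : IsPrimitive 0 1 e d
  zero : e 0 = 0
  one : e 1 = 0
  memLp : MemLp d 2 (volume.restrict (Ioo (0 : ℝ) 1))
  nonneg : 0 ≤ ∫ x in (0 : ℝ)..1, (q x * (d x * e x) + r x * (e x * e x))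

/-- The primitive `∫_0^x (q e' + r e)` of the lower-order terms, for `e' = d`. -/
noncomputable def lowerPrim (q r e d : ℝ → ℝ) (x : ℝ) : ℝ :=
  ∫ t in (0 : ℝ)..x, (q t * d t + r t * e t)

/-- The defect in the flux balance `p e' = c + ∫_0^x (q e' + r e)`. -/
noncomputable def fluxDefect (p q r e d : ℝ → ℝ) (c x : ℝ) : ℝ :=
  p x * d x - (c + lowerPrim q r e d x)

theorem ae_restrict_Icc_of_Ioo {a b : ℝ} {P : ℝ → Prop}
    (h : ∀ᵐ x ∂(volume.restrict (Ioo a b)), P x) : ∀ᵐ x ∂(volume.restrict (Icc a b)), P x := by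
  rwa [← Measure.restrict_congr_set (Ioo_ae_eq_Icc (μ := volume) (a := a) (b := b))]

section

variable {p q r e d : ℝ → ℝ} {M p₀ c : ℝ}

theorem IsAdmissible.intervalIntegrable_sq (h : IsAdmissible q r e d) {a b : ℝ}
    (ha : a ∈ Icc (0 : ℝ) 1) (hb : b ∈ Icc (0 : ℝ) 1) :
    IntervalIntegrable (fun x => d x ^ 2) volume a b := by
  refine IntervalIntegrable.mono_set (a := 0) (b := 1)
    ((intervalIntegrable_iff_integrableOn_Ioo_of_le zero_le_one).2 h.memLp.integrable_sq) ?_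
  rw [uIcc_of_le zero_le_one]
  exact uIcc_subset_Icc ha hb

theorem IsAdmissible.intervalIntegrable_lower (hc : IsBoundedCoeff p q r M p₀)
    (h : IsAdmissible q r e d) :
    IntervalIntegrable (fun t => q t * d t + r t * e t) volume 0 1 := by
  refine (h.prim.integrable.bdd_mul_of_ae zero_le_one hc.q_meas hc.q_le).add ?_
  refine IntervalIntegrable.bdd_mul_of_ae zero_le_one ?_ hc.r_meas hc.r_le
  refine ContinuousOn.intervalIntegrable ?_
  rw [uIcc_of_le zero_le_one]
  exact h.prim.continuousOn

theorem IsAdmissible.isPrimitive_lowerPrim (hc : IsBoundedCoeff p q r M p₀)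
    (h : IsAdmissible q r e d) :
    IsPrimitive 0 1 (lowerPrim q r e d) (fun t => q t * d t + r t * e t) :=
  ⟨h.intervalIntegrable_lower hc, fun x _ => by simp [lowerPrim]⟩

theorem IsAdmissible.integral_sq_mono (h : IsAdmissible q r e d) {a b : ℝ} (ha : 0 ≤ a)
    (hab : a ≤ b) (hb : b ≤ 1) : ∫ x in a..b, d x ^ 2 ≤ ∫ x in (0 : ℝ)..1, d x ^ 2 :=
  intervalIntegral.integral_mono_interval ha hab hb
    (Filter.Eventually.of_forall fun _ => sq_nonneg _)
    (h.intervalIntegrable_sq ⟨le_rfl, zero_le_one⟩ ⟨zero_le_one, le_rfl⟩)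

theorem IsAdmissible.integral_abs_le (h : IsAdmissible q r e d) {a b : ℝ} (ha : 0 ≤ a)
    (hab : a ≤ b) (hb : b ≤ 1) :
    ∫ x in a..b, |d x| ≤ √((b - a) * ∫ x in (0 : ℝ)..1, d x ^ 2) := by
  have ha' : a ∈ Icc (0 : ℝ) 1 := ⟨ha, hab.trans hb⟩
  have hb' : b ∈ Icc (0 : ℝ) 1 := ⟨ha.trans hab, hb⟩
  refine Real.le_sqrt_of_sq_le ((sq_integral_abs_le hab (h.prim.integrable_sub ha' hb')
    (h.intervalIntegrable_sq ha' hb')).trans ?_)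
  exact mul_le_mul_of_nonneg_left (h.integral_sq_mono ha hab hb) (sub_nonneg.2 hab)

/-- The one-dimensional Poincaré–Sobolev inequality. -/
theorem IsAdmissible.abs_le_sqrt (h : IsAdmissible q r e d) {x : ℝ} (hx : x ∈ Icc (0 : ℝ) 1) :
    |e x| ≤ √(∫ x in (0 : ℝ)..1, d x ^ 2) := by
  rw [h.prim.eq x hx, h.zero, zero_add]
  refine (intervalIntegral.abs_integral_le_integral_abs hx.1).trans ?_
  refine (h.integral_abs_le le_rfl hx.1 hx.2).trans (Real.sqrt_le_sqrt ?_)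
  have : 0 ≤ ∫ x in (0 : ℝ)..1, d x ^ 2 :=
    intervalIntegral.integral_nonneg zero_le_one (fun _ _ => sq_nonneg _)
  nlinarith [hx.2]

theorem IsAdmissible.integral_sq_le (h : IsAdmissible q r e d) :
    ∫ x in (0 : ℝ)..1, e x ^ 2 ≤ ∫ x in (0 : ℝ)..1, d x ^ 2 := by
  have hB : 0 ≤ ∫ x in (0 : ℝ)..1, d x ^ 2 :=
    intervalIntegral.integral_nonneg zero_le_one (fun _ _ => sq_nonneg _)
  have h1 : ∫ x in (0 : ℝ)..1, e x ^ 2 ≤ ∫ _ in (0 : ℝ)..1, ∫ x in (0 : ℝ)..1, d x ^ 2 := by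
    refine intervalIntegral.integral_mono_on zero_le_one ?_ (by simp) (fun x hx => ?_)
    · refine ContinuousOn.intervalIntegrable ?_
      rw [uIcc_of_le zero_le_one]
      exact h.prim.continuousOn.pow 2
    · rw [← sq_abs, ← Real.sq_sqrt hB]
      exact pow_le_pow_left₀ (abs_nonneg _) (h.abs_le_sqrt hx) 2
  simpa using h1

/-- `x ↦ ∫_0^x (q e' + r e)` is Hölder continuous of exponent `1/2`. -/
theorem IsAdmissible.sq_lowerPrim_sub_le (hc : IsBoundedCoeff p q r M p₀)
    (h : IsAdmissible q r e d) {a b : ℝ} (ha : 0 ≤ a) (hab : a ≤ b) (hb : b ≤ 1) :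
    (lowerPrim q r e d b - lowerPrim q r e d a) ^ 2
      ≤ 4 * M ^ 2 * (b - a) * ∫ x in (0 : ℝ)..1, d x ^ 2 := by
  have ha' : a ∈ Icc (0 : ℝ) 1 := ⟨ha, hab.trans hb⟩
  have hb' : b ∈ Icc (0 : ℝ) 1 := ⟨ha.trans hab, hb⟩
  set B := ∫ x in (0 : ℝ)..1, d x ^ 2 with hBdef
  have hB : 0 ≤ B := intervalIntegral.integral_nonneg zero_le_one (fun _ _ => sq_nonneg _)
  have hP := h.isPrimitive_lowerPrim hc
  have hss : Icc a b ⊆ Icc (0 : ℝ) 1 := Icc_subset_Icc ha hb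
  rw [hP.sub_eq ha' hb', ← sq_abs]
  have h1 : |∫ t in a..b, (q t * d t + r t * e t)| ≤ 2 * M * √((b - a) * B) := by
    refine (intervalIntegral.abs_integral_le_integral_abs hab).trans ?_
    have h2 : ∫ t in a..b, |q t * d t + r t * e t| ≤ ∫ t in a..b, (M * |d t| + M * √B) := by
      refine intervalIntegral.integral_mono_ae_restrict hab (hP.integrable_sub ha' hb').abs
        (((h.prim.integrable_sub ha' hb').abs.const_mul M).add (by simp)) ?_
      filter_upwards [ae_restrict_of_ae_restrict_of_subset hss (ae_restrict_Icc_of_Ioo hc.q_le),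
        ae_restrict_of_ae_restrict_of_subset hss (ae_restrict_Icc_of_Ioo hc.r_le),
        ae_restrict_mem measurableSet_Icc] with t h1 h2 h3
      refine (abs_add_le _ _).trans ?_
      rw [abs_mul, abs_mul]
      exact add_le_add (mul_le_mul_of_nonneg_right h1 (abs_nonneg _))
        (mul_le_mul h2 (h.abs_le_sqrt (hss h3)) (abs_nonneg _) hc.M_pos.le)
    refine h2.trans ?_
    rw [intervalIntegral.integral_add ((h.prim.integrable_sub ha' hb').abs.const_mul M) (by simp),
      intervalIntegral.integral_const_mul, intervalIntegral.integral_const, smul_eq_mul]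
    have h3 := h.integral_abs_le ha hab hb
    rw [← hBdef] at h3
    have h4 : (b - a) * √B ≤ √((b - a) * B) := by
      refine Real.le_sqrt_of_sq_le ?_
      rw [mul_pow, Real.sq_sqrt hB]
      refine mul_le_mul_of_nonneg_right ?_ hB
      nlinarith
    have := hc.M_pos
    nlinarith
  refine (pow_le_pow_left₀ (abs_nonneg _) h1 2).trans (le_of_eq ?_)
  rw [mul_pow, Real.sq_sqrt (mul_nonneg (sub_nonneg.2 hab) hB)]
  ring

theorem IsAdmissible.sq_lowerPrim_le (hc : IsBoundedCoeff p q r M p₀)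
    (h : IsAdmissible q r e d) {x : ℝ} (hx : x ∈ Icc (0 : ℝ) 1) :
    lowerPrim q r e d x ^ 2 ≤ 4 * M ^ 2 * ∫ x in (0 : ℝ)..1, d x ^ 2 := by
  have hB : 0 ≤ ∫ x in (0 : ℝ)..1, d x ^ 2 :=
    intervalIntegral.integral_nonneg zero_le_one (fun _ _ => sq_nonneg _)
  have h0 := h.sq_lowerPrim_sub_le hc le_rfl hx.1 hx.2
  rw [show lowerPrim q r e d 0 = 0 by simp [lowerPrim], sub_zero, sub_zero] at h0
  refine h0.trans (mul_le_mul_of_nonneg_right ?_ hB)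
  nlinarith [hx.2, sq_nonneg M]

theorem IsAdmissible.memLp_fluxDefect (hc : IsBoundedCoeff p q r M p₀)
    (h : IsAdmissible q r e d) (c : ℝ) :
    MemLp (fluxDefect p q r e d c) 2 (volume.restrict (Ioo (0 : ℝ) 1)) := by
  have hcont : ContinuousOn (fun x => c + lowerPrim q r e d x) (Icc 0 1) :=
    continuousOn_const.add (h.isPrimitive_lowerPrim hc).continuousOn
  obtain ⟨K, hK⟩ := isCompact_Icc.exists_bound_of_continuousOn hcont
  refine MemLp.sub (f := fun x => p x * d x) (g := fun x => c + lowerPrim q r e d x) ?_ ?_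
  · refine MemLp.of_le_mul (c := M) h.memLp (hc.p_meas.mul h.memLp.1) ?_
    filter_upwards [hc.p_le] with x hx
    rw [norm_mul]
    exact mul_le_mul_of_nonneg_right hx (norm_nonneg _)
  · refine MemLp.of_bound
      ((hcont.mono Ioo_subset_Icc_self).aestronglyMeasurable measurableSet_Ioo) K ?_
    filter_upwards [ae_restrict_mem measurableSet_Ioo] with x hx
    exact hK x (Ioo_subset_Icc_self hx)

/-- Coercivity: the energy norm is controlled by the flux defect, because `∫ ((c + Q) e)' = 0` for
`Q = ∫ (q e' + r e)`. -/
theorem IsAdmissible.sq_mul_integral_sq_le (hc : IsBoundedCoeff p q r M p₀)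
    (h : IsAdmissible q r e d) (c : ℝ) :
    p₀ ^ 2 * ∫ x in (0 : ℝ)..1, d x ^ 2 ≤ ∫ x in (0 : ℝ)..1, fluxDefect p q r e d c x ^ 2 := by
  have h01 : (0 : ℝ) ≤ 1 := zero_le_one
  have hp₀ := hc.p₀_pos
  have hP := h.isPrimitive_lowerPrim hc
  have hPc : IsPrimitive 0 1 (fun x => c + lowerPrim q r e d x)
      (fun t => q t * d t + r t * e t) :=
    ⟨hP.integrable, fun x hx => by rw [hP.eq x hx]; ring⟩
  have hprod := hPc.mul h01 h.prim
  have h0 := hprod.sub_eq ⟨le_rfl, h01⟩ ⟨h01, le_rfl⟩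
  rw [h.zero, h.one, mul_zero, mul_zero, sub_zero] at h0
  have hd2 := h.intervalIntegrable_sq (a := 0) (b := 1) ⟨le_rfl, h01⟩ ⟨h01, le_rfl⟩
  have hR2 : IntervalIntegrable (fun x => fluxDefect p q r e d c x ^ 2) volume 0 1 :=
    (intervalIntegrable_iff_integrableOn_Ioo_of_le h01).2 (h.memLp_fluxDefect hc c).integrable_sq
  have hlow : IntervalIntegrable (fun x => q x * (d x * e x) + r x * (e x * e x)) volume 0 1 := by
    refine (hP.integrable.mul_continuousOn (g := e) ?_).congr (fun x _ => by ring)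
    rw [uIcc_of_le h01]; exact h.prim.continuousOn
  have key : ∫ x in (0 : ℝ)..1, (p₀ * d x ^ 2 + (q x * (d x * e x) + r x * (e x * e x)))
      ≤ ∫ x in (0 : ℝ)..1, ((1 / (2 * p₀)) * fluxDefect p q r e d c x ^ 2 + p₀ / 2 * d x ^ 2
        + ((q x * d x + r x * e x) * e x + (c + lowerPrim q r e d x) * d x)) := by
    refine intervalIntegral.integral_mono_ae_restrict h01 ((hd2.const_mul p₀).add hlow)
      (((hR2.const_mul _).add (hd2.const_mul _)).add hprod.integrable) ?_
    filter_upwards [ae_restrict_Icc_of_Ioo hc.le_p] with x hx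
    have h1 : fluxDefect p q r e d c x * d x
        ≤ (1 / (2 * p₀)) * fluxDefect p q r e d c x ^ 2 + p₀ / 2 * d x ^ 2 := by
      have h2 : 0 ≤ (1 / (2 * p₀)) * (fluxDefect p q r e d c x - p₀ * d x) ^ 2 := by positivity
      have h3 : (1 / (2 * p₀)) * (fluxDefect p q r e d c x - p₀ * d x) ^ 2
          = (1 / (2 * p₀)) * fluxDefect p q r e d c x ^ 2 + p₀ / 2 * d x ^ 2
            - fluxDefect p q r e d c x * d x := by
        field_simp; ring
      linarith
    have h4 : p₀ * d x ^ 2 ≤ p x * d x ^ 2 := mul_le_mul_of_nonneg_right hx (sq_nonneg _)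
    have h5 : fluxDefect p q r e d c x * d x
        = p x * d x ^ 2 - (c + lowerPrim q r e d x) * d x := by
      unfold fluxDefect; ring
    nlinarith
  rw [intervalIntegral.integral_add (hd2.const_mul p₀) hlow,
    intervalIntegral.integral_add ((hR2.const_mul _).add (hd2.const_mul _)) hprod.integrable,
    intervalIntegral.integral_add (hR2.const_mul _) (hd2.const_mul _), ← h0,
    intervalIntegral.integral_const_mul, intervalIntegral.integral_const_mul,
    intervalIntegral.integral_const_mul] at key
  have h6 := h.nonneg
  have h7 : p₀ / 2 * ∫ x in (0 : ℝ)..1, d x ^ 2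
      ≤ 1 / (2 * p₀) * ∫ x in (0 : ℝ)..1, fluxDefect p q r e d c x ^ 2 := by linarith
  have h8 := mul_le_mul_of_nonneg_left h7 (show 0 ≤ 2 * p₀ by positivity)
  have h9 : 2 * p₀ * (p₀ / 2 * ∫ x in (0 : ℝ)..1, d x ^ 2)
      = p₀ ^ 2 * ∫ x in (0 : ℝ)..1, d x ^ 2 := by ring
  rw [h9] at h8
  refine h8.trans (le_of_eq ?_)
  field_simp

/-- The flux constant is controlled because `e' = (c + Q + R) / p` has mean zero. -/
theorem IsAdmissible.sq_const_le (hc : IsBoundedCoeff p q r M p₀)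
    (h : IsAdmissible q r e d) (c : ℝ) :
    c ^ 2 ≤ 2 * (M / p₀) ^ 2 * ((∫ x in (0 : ℝ)..1, fluxDefect p q r e d c x ^ 2)
      + 4 * M ^ 2 * ∫ x in (0 : ℝ)..1, d x ^ 2) := by
  have h01 : (0 : ℝ) ≤ 1 := zero_le_one
  have hp₀ := hc.p₀_pos
  have hM := hc.M_pos
  have hP := h.isPrimitive_lowerPrim hc
  have hQc : ContinuousOn (lowerPrim q r e d) (uIcc 0 1) := by
    rw [uIcc_of_le h01]; exact hP.continuousOn
  set R := fluxDefect p q r e d c with hR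
  set Q := lowerPrim q r e d with hQ
  have hRL := h.memLp_fluxDefect hc c
  have hQL : MemLp Q 2 (volume.restrict (Ioo (0 : ℝ) 1)) := by
    obtain ⟨K, hK⟩ := isCompact_Icc.exists_bound_of_continuousOn hP.continuousOn
    refine MemLp.of_bound
      ((hP.continuousOn.mono Ioo_subset_Icc_self).aestronglyMeasurable measurableSet_Ioo) K ?_
    filter_upwards [ae_restrict_mem measurableSet_Ioo] with x hx
    exact hK x (Ioo_subset_Icc_self hx)
  have hRQ : MemLp (fun x => R x + Q x) 2 (volume.restrict (Ioo (0 : ℝ) 1)) := hRL.add hQL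
  have hRQi := hRQ.intervalIntegrable_of_le h01
  have hRQ2 : IntervalIntegrable (fun x => (R x + Q x) ^ 2) volume 0 1 :=
    (intervalIntegrable_iff_integrableOn_Ioo_of_le h01).2 hRQ.integrable_sq
  have hR2 : IntervalIntegrable (fun x => R x ^ 2) volume 0 1 :=
    (intervalIntegrable_iff_integrableOn_Ioo_of_le h01).2 hRL.integrable_sq
  set I := ∫ x in (0 : ℝ)..1, |R x + Q x| with hI
  have hI0 : 0 ≤ I := intervalIntegral.integral_nonneg h01 (fun _ _ => abs_nonneg _)
  have key : ∫ x in (0 : ℝ)..1, (c ^ 2 / M - |c| / p₀ * |R x + Q x|)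
      ≤ ∫ x in (0 : ℝ)..1, c * d x := by
    refine intervalIntegral.integral_mono_ae_restrict h01
      ((by simp : IntervalIntegrable (fun _ => c ^ 2 / M) volume 0 1).sub
        (hRQi.abs.const_mul _)) (h.prim.integrable.const_mul c) ?_
    filter_upwards [ae_restrict_Icc_of_Ioo hc.le_p, ae_restrict_Icc_of_Ioo hc.p_le] with x h1 h2
    have hpx : 0 < p x := hp₀.trans_le h1
    have e1 : c * d x = c ^ 2 / p x + c * (R x + Q x) / p x := by
      simp only [hR, fluxDefect]
      field_simp
      ring
    have e2 : c ^ 2 / M ≤ c ^ 2 / p x :=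
      div_le_div_of_nonneg_left (sq_nonneg _) hpx ((le_abs_self _).trans h2)
    have e3 : -(|c| / p₀ * |R x + Q x|) ≤ c * (R x + Q x) / p x := by
      have h3 : |c * (R x + Q x) / p x| ≤ |c| * |R x + Q x| / p₀ := by
        rw [abs_div, abs_mul, abs_of_pos hpx]
        exact div_le_div_of_nonneg_left (by positivity) hp₀ h1
      have h4 := (abs_le.1 h3).1
      have h5 : |c| / p₀ * |R x + Q x| = |c| * |R x + Q x| / p₀ := by ring
      rw [h5]; exact h4
    rw [e1]
    linarith
  have hd0 : ∫ x in (0 : ℝ)..1, d x = 0 := by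
    rw [← h.prim.sub_eq ⟨le_rfl, h01⟩ ⟨h01, le_rfl⟩, h.zero, h.one, sub_zero]
  rw [intervalIntegral.integral_sub (by simp) (hRQi.abs.const_mul _),
    intervalIntegral.integral_const_mul, intervalIntegral.integral_const_mul, hd0,
    intervalIntegral.integral_const, ← hI, mul_zero, sub_zero, one_smul] at key
  have hcI : |c| ≤ M / p₀ * I := by
    rcases eq_or_ne c 0 with h0 | h0
    · rw [h0, abs_zero]; positivity
    · have hpos : 0 < |c| := abs_pos.2 h0
      have h3 : |c| * (|c| / M) ≤ |c| * (I / p₀) := by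
        have e1 : |c| * (|c| / M) = c ^ 2 / M := by rw [← sq_abs]; ring
        have e2 : |c| * (I / p₀) = |c| / p₀ * I := by ring
        rw [e1, e2]; linarith
      have h4 := le_of_mul_le_mul_left h3 hpos
      rw [div_le_iff₀ hM] at h4
      refine h4.trans (le_of_eq (by ring))
  have hI2 : I ^ 2
      ≤ 2 * ((∫ x in (0 : ℝ)..1, R x ^ 2) + 4 * M ^ 2 * ∫ x in (0 : ℝ)..1, d x ^ 2) := by
    have h1 := sq_integral_abs_le h01 hRQi hRQ2
    rw [sub_zero, one_mul] at h1
    refine h1.trans ?_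
    have h2 : ∫ x in (0 : ℝ)..1, (R x + Q x) ^ 2
        ≤ ∫ x in (0 : ℝ)..1, (2 * R x ^ 2 + 2 * (4 * M ^ 2 * ∫ x in (0 : ℝ)..1, d x ^ 2)) := by
      refine intervalIntegral.integral_mono_on h01 hRQ2 ((hR2.const_mul 2).add (by simp))
        (fun x hx => ?_)
      have := h.sq_lowerPrim_le hc hx
      rw [← hQ] at this
      nlinarith [sq_nonneg (R x - Q x)]
    rw [intervalIntegral.integral_add (hR2.const_mul 2) (by simp),
      intervalIntegral.integral_const_mul, intervalIntegral.integral_const, sub_zero,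
      one_smul] at h2
    linarith
  rw [← sq_abs]
  refine (pow_le_pow_left₀ (abs_nonneg _) hcI 2).trans ?_
  rw [mul_pow]
  have := mul_le_mul_of_nonneg_left hI2 (sq_nonneg (M / p₀))
  linarith

end

end FVE

/-! ### The self-bounding estimate of the flux defect -/

namespace FVE

theorem sq_sum_mul_le {s : Finset ℕ} {l a : ℕ → ℝ} {L : ℝ} (hl : ∀ j ∈ s, |l j| ≤ L) :
    (∑ j ∈ s, l j * a j) ^ 2 ≤ L ^ 2 * s.card * ∑ j ∈ s, a j ^ 2 := by
  have h1 : ∑ j ∈ s, (l j * a j) ^ 2 ≤ L ^ 2 * ∑ j ∈ s, a j ^ 2 := by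
    rw [Finset.mul_sum]
    refine Finset.sum_le_sum fun j hj => ?_
    rw [mul_pow, ← sq_abs (l j)]
    exact mul_le_mul_of_nonneg_right (pow_le_pow_left₀ (abs_nonneg _) (hl j hj) 2) (sq_nonneg _)
  have h2 := mul_le_mul_of_nonneg_left h1 (Nat.cast_nonneg (α := ℝ) s.card)
  exact sq_sum_le_card_mul_sum_sq.trans (h2.trans (le_of_eq (by ring)))

/-- If the flux balance holds at the nodes, the defect at another point is caused by the
variation of `p` and of `Q` and by the interpolation error of the derivative. -/
theorem sq_defect_le {s : Finset ℕ} {l P D Q : ℕ → ℝ} {L M p dx c Qx E W ρ : ℝ}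
    (hl : ∀ j ∈ s, |l j| ≤ L) (hl1 : ∑ j ∈ s, l j = 1)
    (hflux : ∀ j ∈ s, P j * D j = c + Q j) (hD : ∀ j ∈ s, D j ^ 2 ≤ E)
    (hQ : ∀ j ∈ s, (Q j - Qx) ^ 2 ≤ W) (hp : |p| ≤ M) (hdx : |dx - ∑ j ∈ s, l j * D j| ≤ ρ) :
    (p * dx - (c + Qx)) ^ 2 ≤ 3 * (L ^ 2 * s.card * E * ∑ j ∈ s, (p - P j) ^ 2
      + L ^ 2 * s.card ^ 2 * W + M ^ 2 * ρ ^ 2) := by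
  have e : p * dx - (c + Qx) = ∑ j ∈ s, l j * ((p - P j) * D j) + ∑ j ∈ s, l j * (Q j - Qx)
      + p * (dx - ∑ j ∈ s, l j * D j) := by
    have e1 : ∑ j ∈ s, l j * ((p - P j) * D j)
        = p * ∑ j ∈ s, l j * D j - ∑ j ∈ s, l j * (c + Q j) := by
      rw [Finset.mul_sum, ← Finset.sum_sub_distrib]
      exact Finset.sum_congr rfl fun j hj => by rw [← hflux j hj]; ring
    have e2 : ∑ j ∈ s, l j * (Q j - Qx) = ∑ j ∈ s, l j * (c + Q j) - (c + Qx) * ∑ j ∈ s, l j := by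
      rw [Finset.mul_sum, ← Finset.sum_sub_distrib]
      exact Finset.sum_congr rfl fun j _ => by ring
    rw [e1, e2, hl1]; ring
  have h1 : (∑ j ∈ s, l j * ((p - P j) * D j)) ^ 2
      ≤ L ^ 2 * s.card * E * ∑ j ∈ s, (p - P j) ^ 2 := by
    have h2 : ∑ j ∈ s, ((p - P j) * D j) ^ 2 ≤ E * ∑ j ∈ s, (p - P j) ^ 2 := by
      rw [Finset.mul_sum]
      refine Finset.sum_le_sum fun j hj => ?_
      rw [mul_pow, mul_comm]
      exact mul_le_mul_of_nonneg_right (hD j hj) (sq_nonneg _)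
    have h3 : 0 ≤ L ^ 2 * (s.card : ℝ) := by positivity
    exact (sq_sum_mul_le hl).trans
      ((mul_le_mul_of_nonneg_left h2 h3).trans (le_of_eq (by ring)))
  have h2 : (∑ j ∈ s, l j * (Q j - Qx)) ^ 2 ≤ L ^ 2 * s.card ^ 2 * W := by
    refine (sq_sum_mul_le hl).trans ?_
    have h3 : ∑ j ∈ s, (Q j - Qx) ^ 2 ≤ s.card * W := by
      simpa using Finset.sum_le_sum hQ
    refine (mul_le_mul_of_nonneg_left h3 (by positivity)).trans (le_of_eq (by ring))
  have h3 : (p * (dx - ∑ j ∈ s, l j * D j)) ^ 2 ≤ M ^ 2 * ρ ^ 2 := by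
    rw [mul_pow, ← sq_abs p, ← sq_abs (dx - _)]
    exact mul_le_mul (pow_le_pow_left₀ (abs_nonneg _) hp 2)
      (pow_le_pow_left₀ (abs_nonneg _) hdx 2) (sq_nonneg _) (sq_nonneg _)
  rw [e]
  set x := ∑ j ∈ s, l j * ((p - P j) * D j)
  set y := ∑ j ∈ s, l j * (Q j - Qx)
  set z := p * (dx - ∑ j ∈ s, l j * D j)
  nlinarith [sq_nonneg (x - y), sq_nonneg (x - z), sq_nonneg (y - z)]

/-- The node of `K_i` that is the affine image of the reference point `G j`. -/
noncomputable def Mesh.node (T : Mesh) (G : ℕ → ℝ) (i j : ℕ) : ℝ :=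
  (T.x i + T.x (i - 1) + T.len i * G j) / 2

/-- The constant in the bound of the squared nodal values of the error derivative by the squared
norm of the flux defect. -/
noncomputable def nodalConst (M p₀ : ℝ) : ℝ :=
  2 * (2 * (M / p₀) ^ 2 * (1 + 4 * M ^ 2 / p₀ ^ 2) + 4 * M ^ 2 / p₀ ^ 2) / p₀ ^ 2

section

variable {p q r e d : ℝ → ℝ} {M p₀ c : ℝ}

theorem integral_sq_fluxDefect_nonneg :
    0 ≤ ∫ x in (0 : ℝ)..1, fluxDefect p q r e d c x ^ 2 :=
  intervalIntegral.integral_nonneg zero_le_one (fun _ _ => sq_nonneg _)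

theorem IsAdmissible.integral_sq_le_div (hc : IsBoundedCoeff p q r M p₀)
    (h : IsAdmissible q r e d) (c : ℝ) :
    ∫ x in (0 : ℝ)..1, d x ^ 2 ≤ (∫ x in (0 : ℝ)..1, fluxDefect p q r e d c x ^ 2) / p₀ ^ 2 := by
  have hp₀ := hc.p₀_pos
  rw [le_div_iff₀ (by positivity), mul_comm]
  exact h.sq_mul_integral_sq_le hc c

/-- By the flux balance, nodal values of the error derivative are controlled by the defect. -/
theorem IsAdmissible.sq_nodal_le (hc : IsBoundedCoeff p q r M p₀)
    (h : IsAdmissible q r e d) {x P D : ℝ} (hx : x ∈ Icc (0 : ℝ) 1) (hP : p₀ ≤ P)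
    (hflux : P * D = c + lowerPrim q r e d x) :
    D ^ 2 ≤ nodalConst M p₀ * ∫ x in (0 : ℝ)..1, fluxDefect p q r e d c x ^ 2 := by
  have hp₀ := hc.p₀_pos
  set A := ∫ x in (0 : ℝ)..1, fluxDefect p q r e d c x ^ 2 with hA
  have h1 := h.integral_sq_le_div hc c
  have h2 := h.sq_const_le hc c
  have h3 := h.sq_lowerPrim_le hc hx
  rw [← hA] at h1 h2
  have h4 : 4 * M ^ 2 * ∫ x in (0 : ℝ)..1, d x ^ 2 ≤ 4 * M ^ 2 * (A / p₀ ^ 2) :=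
    mul_le_mul_of_nonneg_left h1 (by positivity)
  have h5 : c ^ 2 ≤ 2 * (M / p₀) ^ 2 * (A + 4 * M ^ 2 * (A / p₀ ^ 2)) :=
    h2.trans (mul_le_mul_of_nonneg_left (by linarith) (by positivity))
  have h6 : p₀ ^ 2 * D ^ 2 ≤ 2 * (c ^ 2 + lowerPrim q r e d x ^ 2) := by
    have : p₀ ^ 2 * D ^ 2 ≤ (P * D) ^ 2 := by
      rw [mul_pow]
      exact mul_le_mul_of_nonneg_right (pow_le_pow_left₀ hp₀.le hP 2) (sq_nonneg _)
    rw [hflux] at this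
    nlinarith [sq_nonneg (c - lowerPrim q r e d x)]
  have h7 : D ^ 2 ≤ 2 * (2 * (M / p₀) ^ 2 * (A + 4 * M ^ 2 * (A / p₀ ^ 2))
      + 4 * M ^ 2 * (A / p₀ ^ 2)) / p₀ ^ 2 := by
    rw [le_div_iff₀ (by positivity), mul_comm]
    linarith
  refine h7.trans (le_of_eq ?_)
  unfold nodalConst
  ring

/-- The self-bounding estimate for the flux defect `R`: apart from the interpolation errors `η`,
its squared norm is at most a small multiple of itself. -/
theorem IsAdmissible.integral_sq_fluxDefect_le (hc : IsBoundedCoeff p q r M p₀)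
    (h : IsAdmissible q r e d) {T : Mesh} {k : ℕ} {G : ℕ → ℝ}
    (hG : ∀ j ∈ Finset.Icc 1 k, G j ∈ Ioo (-1 : ℝ) 1) {l : ℕ → ℝ → ℝ} {L : ℝ}
    (hl : ∀ j ∈ Finset.Icc 1 k, ∀ t ∈ Icc (-1 : ℝ) 1, |l j t| ≤ L)
    (hl1 : ∀ t, ∑ j ∈ Finset.Icc 1 k, l j t = 1)
    {D : ℕ → ℕ → ℝ} {η : ℕ → ℝ} {ε : ℝ}
    (hflux : ∀ i ∈ Finset.Icc 1 T.N, ∀ j ∈ Finset.Icc 1 k,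
      p (T.node G i j) * D i j = c + lowerPrim q r e d (T.node G i j))
    (hpn : ∀ i ∈ Finset.Icc 1 T.N, ∀ j ∈ Finset.Icc 1 k, p₀ ≤ p (T.node G i j))
    (happ : ∀ i ∈ Finset.Icc 1 T.N, ∀ᵐ x ∂(volume.restrict (Ioo (T.x (i - 1)) (T.x i))),
      |d x - ∑ j ∈ Finset.Icc 1 k,
        l j ((2 * x - T.x (i - 1) - T.x i) / (T.x i - T.x (i - 1))) * D i j| ≤ η i)
    (hosc : ∀ j ∈ Finset.Icc 1 k, ∑ i ∈ Finset.Icc 1 T.N, ∫ y in (T.x (i - 1))..(T.x i),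
        (p y - p (T.node G i j)) ^ 2 ≤ ε) :
    ∫ x in (0 : ℝ)..1, fluxDefect p q r e d c x ^ 2 ≤
      3 * (L ^ 2 * k ^ 2 * nodalConst M p₀ * ε + 4 * L ^ 2 * k ^ 2 * M ^ 2 / p₀ ^ 2 * T.h)
        * (∫ x in (0 : ℝ)..1, fluxDefect p q r e d c x ^ 2)
      + 3 * M ^ 2 * ∑ i ∈ Finset.Icc 1 T.N, T.len i * η i ^ 2 := by
  have h01 : (0 : ℝ) ≤ 1 := zero_le_one
  have hp₀ := hc.p₀_pos
  set A := ∫ x in (0 : ℝ)..1, fluxDefect p q r e d c x ^ 2 with hA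
  have hA0 : 0 ≤ A := integral_sq_fluxDefect_nonneg
  set E := nodalConst M p₀ * A with hE
  have hE0 : 0 ≤ E := by rw [hE]; unfold nodalConst; positivity
  set W := 4 * M ^ 2 * T.h * (A / p₀ ^ 2) with hW
  have hR2 : IntervalIntegrable (fun x => fluxDefect p q r e d c x ^ 2) volume 0 1 :=
    (intervalIntegrable_iff_integrableOn_Ioo_of_le h01).2 (h.memLp_fluxDefect hc c).integrable_sq
  have hpL : MemLp p 2 (volume.restrict (Ioo (0 : ℝ) 1)) :=
    MemLp.of_bound hc.p_meas M hc.p_le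
  have hp2 : ∀ s : ℝ, IntervalIntegrable (fun y => (p y - s) ^ 2) volume 0 1 := fun s =>
    (intervalIntegrable_iff_integrableOn_Ioo_of_le h01).2
      (hpL.sub (memLp_const s)).integrable_sq
  have hcard : (Finset.Icc 1 k).card = k := by rw [Nat.card_Icc, Nat.add_sub_cancel]
  have hsubset : ∀ i ∈ Finset.Icc 1 T.N, uIcc (T.x (i - 1)) (T.x i) ⊆ uIcc 0 1 := fun i hi => by
    rw [uIcc_of_le h01]
    exact uIcc_subset_Icc (Mesh.x_pred_mem hi) (Mesh.x_mem' hi)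
  have helem : ∀ i ∈ Finset.Icc 1 T.N,
      ∫ x in (T.x (i - 1))..(T.x i), fluxDefect p q r e d c x ^ 2 ≤
        3 * (L ^ 2 * k * E * (∑ j ∈ Finset.Icc 1 k, ∫ y in (T.x (i - 1))..(T.x i),
          (p y - p (T.node G i j)) ^ 2) + T.len i * (L ^ 2 * k ^ 2 * W)
          + T.len i * (M ^ 2 * η i ^ 2)) := by
    intro i hi
    have hlt := Mesh.x_pred_lt hi
    have hint : ∀ j, IntervalIntegrable (fun y => (p y - p (T.node G i j)) ^ 2) volume
        (T.x (i - 1)) (T.x i) := fun j => (hp2 _).mono_set (hsubset i hi)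
    have hsum : IntervalIntegrable
        (fun y => ∑ j ∈ Finset.Icc 1 k, (p y - p (T.node G i j)) ^ 2) volume
        (T.x (i - 1)) (T.x i) := by
      have := IntervalIntegrable.sum (Finset.Icc 1 k) (fun j _ => hint j)
      refine this.congr (fun x _ => by simp)
    have hle : ∫ x in (T.x (i - 1))..(T.x i), fluxDefect p q r e d c x ^ 2 ≤
        ∫ x in (T.x (i - 1))..(T.x i),
          (3 * (L ^ 2 * k * E) * ∑ j ∈ Finset.Icc 1 k, (p x - p (T.node G i j)) ^ 2
          + 3 * (L ^ 2 * k ^ 2 * W + M ^ 2 * η i ^ 2)) := by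
      refine intervalIntegral.integral_mono_ae_restrict hlt.le (hR2.mono_set (hsubset i hi))
        ((hsum.const_mul _).add (by simp)) ?_
      have hss := Mesh.Ioo_subset hi
      filter_upwards [ae_restrict_Icc_of_Ioo (happ i hi),
        ae_restrict_Icc_of_Ioo (ae_restrict_of_ae_restrict_of_subset hss hc.p_le),
        ae_restrict_mem measurableSet_Icc] with x hx1 hx2 hx3
      have ht : (2 * x - T.x (i - 1) - T.x i) / (T.x i - T.x (i - 1)) ∈ Icc (-1 : ℝ) 1 := by
        have := sub_pos.2 hlt
        constructor
        · rw [le_div_iff₀ this]; linarith [hx3.1]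
        · rw [div_le_iff₀ this]; linarith [hx3.2]
      have hnode : ∀ j ∈ Finset.Icc 1 k, T.node G i j ∈ Ioo (T.x (i - 1)) (T.x i) :=
        fun j hj => Mesh.node_mem hi (hG j hj)
      have := sq_defect_le (s := Finset.Icc 1 k) (L := L) (M := M) (p := p x) (dx := d x) (c := c)
        (Qx := lowerPrim q r e d x) (E := E) (W := W) (ρ := η i)
        (l := fun j => l j ((2 * x - T.x (i - 1) - T.x i) / (T.x i - T.x (i - 1))))
        (P := fun j => p (T.node G i j)) (D := D i)
        (Q := fun j => lowerPrim q r e d (T.node G i j))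
        (fun j hj => hl j hj _ ht) (hl1 _) (hflux i hi)
        (fun j hj => h.sq_nodal_le hc (Mesh.Icc_subset hi (Ioo_subset_Icc_self (hnode j hj)))
          (hpn i hi j hj) (hflux i hi j hj))
        (fun j hj => ?_) hx2 hx1
      · rw [hcard] at this
        unfold fluxDefect
        refine this.trans (le_of_eq (by ring))
      · have hB := h.integral_sq_le_div hc c
        rw [← hA] at hB
        have hB0 : 0 ≤ ∫ x in (0 : ℝ)..1, d x ^ 2 :=
          intervalIntegral.integral_nonneg h01 (fun _ _ => sq_nonneg _)
        have hlen : T.x i - T.x (i - 1) ≤ T.h := Mesh.len_le_h hi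
        have hfin : ∀ s : ℝ, s ≤ T.h →
            4 * M ^ 2 * s * (∫ x in (0 : ℝ)..1, d x ^ 2) ≤ W := fun s hs =>
          mul_le_mul (mul_le_mul_of_nonneg_left hs (by positivity)) hB hB0
            (mul_nonneg (by positivity) Mesh.h_pos.le)
        have hn := hnode j hj
        have hx01 := Mesh.Icc_subset hi hx3
        have hn01 := Mesh.Icc_subset hi (Ioo_subset_Icc_self hn)
        rcases le_total x (T.node G i j) with hxn | hxn
        · exact (h.sq_lowerPrim_sub_le hc hx01.1 hxn hn01.2).trans
            (hfin _ (by linarith [hn.2, hx3.1]))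
        · rw [← neg_sub, neg_sq]
          exact (h.sq_lowerPrim_sub_le hc hn01.1 hxn hx01.2).trans
            (hfin _ (by linarith [hn.1, hx3.2]))
    refine hle.trans (le_of_eq ?_)
    rw [intervalIntegral.integral_add (hsum.const_mul _) (by simp),
      intervalIntegral.integral_const_mul, intervalIntegral.integral_finsetSum (fun j _ => hint j),
      intervalIntegral.integral_const, smul_eq_mul, Mesh.len]
    ring
  have hAsum : A = ∑ i ∈ Finset.Icc 1 T.N,
      ∫ x in (T.x (i - 1))..(T.x i), fluxDefect p q r e d c x ^ 2 := (Mesh.sum_integral hR2).symm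
  have hosc' : ∑ i ∈ Finset.Icc 1 T.N, ∑ j ∈ Finset.Icc 1 k, ∫ y in (T.x (i - 1))..(T.x i),
      (p y - p (T.node G i j)) ^ 2 ≤ k * ε := by
    rw [Finset.sum_comm]
    refine (Finset.sum_le_sum hosc).trans (le_of_eq ?_)
    rw [Finset.sum_const, hcard, nsmul_eq_mul]
  have htot := hAsum.le.trans (Finset.sum_le_sum helem)
  rw [← Finset.mul_sum, Finset.sum_add_distrib, Finset.sum_add_distrib, ← Finset.mul_sum,
    ← Finset.sum_mul, Mesh.sum_len, one_mul] at htot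
  have e3 : ∑ i ∈ Finset.Icc 1 T.N, T.len i * (M ^ 2 * η i ^ 2)
      = M ^ 2 * ∑ i ∈ Finset.Icc 1 T.N, T.len i * η i ^ 2 := by
    rw [Finset.mul_sum]
    exact Finset.sum_congr rfl fun i _ => by ring
  rw [e3] at htot
  have h4 := mul_le_mul_of_nonneg_left hosc' (show 0 ≤ L ^ 2 * k * E by positivity)
  refine htot.trans ?_
  have e4 : 3 * (L ^ 2 * k ^ 2 * nodalConst M p₀ * ε + 4 * L ^ 2 * k ^ 2 * M ^ 2 / p₀ ^ 2 * T.h)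
      * A = 3 * (L ^ 2 * k * E * (k * ε) + L ^ 2 * k ^ 2 * W) := by
    rw [hE, hW]; ring
  rw [e4]
  linarith

end

end FVE

/-! ### Flux balances of the discrete and of the continuous problem -/

namespace FVE

namespace Mesh

variable {T : Mesh} {k : ℕ} {G : ℕ → ℝ} {w : ℝ → ℝ} {i j : ℕ}

theorem MemTrial.exists_polynomial (hw : T.MemTrial k w) (hi : i ∈ Finset.Icc 1 T.N) :
    ∃ P : Polynomial ℝ, P.natDegree ≤ k ∧ (∀ y ∈ Icc (T.x (i - 1)) (T.x i), w y = P.eval y) ∧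
      ∀ y ∈ Ioo (T.x (i - 1)) (T.x i), deriv w y = P.derivative.eval y := by
  obtain ⟨P, hP, hwP⟩ := hw.2.2.2 i hi
  refine ⟨P, hP, hwP, fun y hy => ?_⟩
  rw [← Polynomial.deriv]
  refine Filter.EventuallyEq.deriv_eq ?_
  filter_upwards [Ioo_mem_nhds hy.1 hy.2] with z hz
  exact hwP z (Ioo_subset_Icc_self hz)

/-- Trial functions are absolutely continuous; their classical derivative exists except at the mesh
points, where the junk value of `deriv` does not matter. -/
theorem MemTrial.isPrimitive (hw : T.MemTrial k w) : IsPrimitive 0 1 w (deriv w) := by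
  have key : ∀ n ≤ T.N, IsPrimitive 0 (T.x n) w (deriv w) := by
    intro n
    induction n with
    | zero =>
      intro _
      rw [T.x_zero]
      refine ⟨by simp, fun x hx => ?_⟩
      rw [show x = 0 from le_antisymm hx.2 hx.1]; simp
    | succ n ih =>
      intro hn
      have hi : n + 1 ∈ Finset.Icc 1 T.N := Finset.mem_Icc.2 ⟨by omega, hn⟩
      obtain ⟨P, -, hwP, hwd⟩ := hw.exists_polynomial hi
      refine (ih (by omega)).trans (T.x_mem (by omega)).1 ?_
      refine ((isPrimitive_polynomial P _ _).congr_left hwP).congr_ae (x_pred_lt hi).le ?_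
      filter_upwards [ae_restrict_mem measurableSet_Ioo] with x hx
      exact (hwd x hx).symm
  have := key T.N le_rfl
  rwa [T.x_last] at this

theorem MemTrial.memLp_deriv (hw : T.MemTrial k w) :
    MemLp (deriv w) 2 (volume.restrict (Ioo (0 : ℝ) 1)) := by
  have hb : ∀ i ∈ Finset.Icc 1 T.N, ∃ B, ∀ y ∈ Ioo (T.x (i - 1)) (T.x i), |deriv w y| ≤ B := by
    intro i hi
    obtain ⟨P, -, -, hwd⟩ := hw.exists_polynomial hi
    obtain ⟨B, hB⟩ := isCompact_Icc.exists_bound_of_continuousOn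
      (s := Icc (T.x (i - 1)) (T.x i)) P.derivative.continuous.continuousOn
    exact ⟨B, fun y hy => by rw [hwd y hy]; exact hB y (Ioo_subset_Icc_self hy)⟩
  choose! B hB using hb
  refine MemLp.of_bound ((intervalIntegrable_iff_integrableOn_Ioo_of_le zero_le_one).1
    hw.isPrimitive.integrable).1 (∑ i ∈ Finset.Icc 1 T.N, |B i|) ?_
  rw [Measure.restrict_congr_set (Ioo_ae_eq_Ioc (μ := volume) (a := (0 : ℝ)) (b := 1))]
  filter_upwards [ae_exists_mem_Ioo T] with y hy
  obtain ⟨i, hi, hyi⟩ := hy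
  exact ((hB i hi y hyi).trans (le_abs_self _)).trans
    (Finset.single_le_sum (f := fun i => |B i|) (fun _ _ => abs_nonneg _) hi)

theorem dualPt_eq_node (hj : j ≤ k) : T.dualPt k G i j = T.node G i j := by
  rw [dualPt, if_pos hj, node]

theorem dualPt_succ (hi : i < T.N) : T.dualPt k G i (k + 1) = T.node G (i + 1) 1 := by
  rw [dualPt, if_neg (by omega), if_pos hi, node, Nat.add_sub_cancel]

theorem dualPt_last (T : Mesh) : T.dualPt k G T.N (k + 1) = 1 := by
  rw [dualPt, if_neg (by omega), if_neg (lt_irrefl _)]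

theorem node_mem_Ioo (hG : IsSymmDualPoints k G) (hi : i ∈ Finset.Icc 1 T.N)
    (hj : j ∈ Finset.Icc 1 k) : T.node G i j ∈ Ioo (T.x (i - 1)) (T.x i) :=
  node_mem hi (hG.mem j hj)

theorem node_mem_Icc (hG : IsSymmDualPoints k G) (hi : i ∈ Finset.Icc 1 T.N)
    (hj : j ∈ Finset.Icc 1 k) : T.node G i j ∈ Icc (0 : ℝ) 1 :=
  Icc_subset hi (Ioo_subset_Icc_self (node_mem_Ioo hG hi hj))

theorem dualPt_le_succ (hG : IsSymmDualPoints k G) (hi : i ∈ Finset.Icc 1 T.N)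
    (hj : j ∈ Finset.Icc 1 k) :
    T.dualPt k G i j ≤ T.dualPt k G i (j + 1) ∧ T.dualPt k G i (j + 1) ∈ Icc (0 : ℝ) 1 := by
  have hj' := Finset.mem_Icc.1 hj
  have hi' := Finset.mem_Icc.1 hi
  rw [dualPt_eq_node hj'.2]
  rcases lt_or_eq_of_le hj'.2 with hjk | rfl
  · have hj1 : j + 1 ∈ Finset.Icc 1 k := Finset.mem_Icc.2 ⟨by omega, hjk⟩
    rw [dualPt_eq_node hjk]
    refine ⟨?_, node_mem_Icc hG hi hj1⟩
    have := mul_le_mul_of_nonneg_left (hG.lt j hj _ hj1 (Nat.lt_succ_self j)).le (len_pos hi).le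
    rw [node, node]; linarith
  · rcases lt_or_eq_of_le hi'.2 with hiN | hiN
    · have hi1 : i + 1 ∈ Finset.Icc 1 T.N := Finset.mem_Icc.2 ⟨by omega, hiN⟩
      have h1j : 1 ∈ Finset.Icc 1 j := Finset.mem_Icc.2 ⟨le_rfl, hj'.1⟩
      rw [dualPt_succ hiN]
      refine ⟨(node_mem_Ioo hG hi hj).2.le.trans ?_, node_mem_Icc hG hi1 h1j⟩
      have := (node_mem_Ioo hG hi1 h1j).1.le
      rwa [Nat.add_sub_cancel] at this
    · rw [hiN, dualPt_last, ← hiN]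
      exact ⟨(node_mem_Icc hG hi hj).2, zero_le_one, le_rfl⟩

theorem dualPt_mem (hG : IsSymmDualPoints k G) (hi : i ∈ Finset.Icc 1 T.N)
    (hj : j ∈ Finset.Icc 1 k) : T.dualPt k G i j ∈ Icc (0 : ℝ) 1 := by
  rw [dualPt_eq_node (Finset.mem_Icc.1 hj).2]
  exact node_mem_Icc hG hi hj

theorem integral_mul_testFun (hG : IsSymmDualPoints k G) {f : ℝ → ℝ}
    (hf : IntegrableOn f (Ioo (0 : ℝ) 1)) (v : ℕ → ℕ → ℝ) :
    ∫ y in Ioo (0 : ℝ) 1, f y * T.testFun k G v y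
      = ∑ i ∈ Finset.Icc 1 T.N, ∑ j ∈ Finset.Icc 1 k,
        v i j * ∫ y in (T.dualPt k G i j)..(T.dualPt k G i (j + 1)), f y := by
  rw [← integral_Icc_eq_integral_Ioo]
  have hf' : IntegrableOn f (Icc (0 : ℝ) 1) := by
    rwa [integrableOn_Icc_iff_integrableOn_Ioo]
  have e : ∀ y, f y * T.testFun k G v y = ∑ i ∈ Finset.Icc 1 T.N, ∑ j ∈ Finset.Icc 1 k,
      (Icc (T.dualPt k G i j) (T.dualPt k G i (j + 1))).indicator (fun z => v i j * f z) y := by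
    intro y
    rw [testFun, Finset.mul_sum]
    refine Finset.sum_congr rfl fun i _ => ?_
    rw [Finset.mul_sum]
    refine Finset.sum_congr rfl fun j _ => ?_
    by_cases hy : y ∈ Icc (T.dualPt k G i j) (T.dualPt k G i (j + 1))
    · rw [indicator_of_mem hy, indicator_of_mem hy, mul_comm]
    · rw [indicator_of_notMem hy, indicator_of_notMem hy, mul_zero]
  have hint : ∀ i j, IntegrableOn
      ((Icc (T.dualPt k G i j) (T.dualPt k G i (j + 1))).indicator (fun z => v i j * f z))
      (Icc (0 : ℝ) 1) := fun i j => (hf'.const_mul (v i j)).indicator measurableSet_Icc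
  simp only [e]
  rw [integral_finsetSum _ (fun i _ => integrable_finsetSum _ (fun j _ => hint i j))]
  refine Finset.sum_congr rfl fun i hi => ?_
  rw [integral_finsetSum _ (fun j _ => hint i j)]
  refine Finset.sum_congr rfl fun j hj => ?_
  have h1 := dualPt_le_succ hG hi hj
  rw [setIntegral_indicator measurableSet_Icc,
    inter_eq_right.2 (Icc_subset_Icc (dualPt_mem hG hi hj).1 h1.2.2), integral_const_mul,
    integral_Icc_eq_integral_Ioc, intervalIntegral.integral_of_le h1.1]

theorem double_sum_eq_single {s t : Finset ℕ} {f : ℕ → ℕ → ℝ} {a b : ℕ} (ha : a ∈ s) (hb : b ∈ t)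
    (h : ∀ i ∈ s, ∀ j ∈ t, ¬(i = a ∧ j = b) → f i j = 0) : ∑ i ∈ s, ∑ j ∈ t, f i j = f a b := by
  rw [Finset.sum_eq_single_of_mem a ha, Finset.sum_eq_single_of_mem b hb]
  · intro j hj hne
    exact h a ha j hj (fun h' => hne h'.2)
  · intro i hi hne
    exact Finset.sum_eq_zero fun j hj => h i hi j hj (fun h' => hne h'.1)

/-- Testing the scheme with the characteristic function of one dual cell: the flux balance on that
cell, whose right end point is the dual point with index `(i', j')`. -/
theorem IsFVESolution.flux_sub_eq {p q r f : ℝ → ℝ} (hG : IsSymmDualPoints k G)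
    (hf : IntegrableOn f (Ioo (0 : ℝ) 1)) (hw : T.IsFVESolution k G p q r f w)
    {i j i' j' : ℕ} (hi : i ∈ Finset.Icc 1 T.N) (hj : j ∈ Finset.Icc 1 k)
    (hi' : i' ∈ Finset.Icc 1 T.N) (hj' : j' ∈ Finset.Icc 1 k)
    (hnext : (i' = i ∧ j' = j + 1) ∨ (i' = i + 1 ∧ j' = 1 ∧ j = k)) :
    p (T.node G i' j') * deriv w (T.node G i' j') - p (T.node G i j) * deriv w (T.node G i j)
      = (∫ y in (T.node G i j)..(T.node G i' j'), (q y * deriv w y + r y * w y))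
        - ∫ y in (T.node G i j)..(T.node G i' j'), f y := by
  have hi1 := Finset.mem_Icc.1 hi
  have hj1 := Finset.mem_Icc.1 hj
  have hi1' := Finset.mem_Icc.1 hi'
  have hj1' := Finset.mem_Icc.1 hj'
  -- The second alternative is the convention `v_{i+1,0} = v_{i,k}`.
  set v : ℕ → ℕ → ℝ := fun a b =>
    if (a = i ∧ b = j) ∨ (j = k ∧ a = i + 1 ∧ b = 0) then 1 else 0 with hv
  have hcoeff : T.IsTestCoeff k v := by
    refine ⟨?_, ?_, fun a ha => ?_⟩
    · simp only [hv]; rw [if_neg (by omega)]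
    · simp only [hv]; rw [if_neg (by omega)]
    · rw [Finset.mem_Icc] at ha
      simp only [hv, and_true]
      refine if_congr ?_ rfl rfl
      omega
  have hmain := hw.2 v hcoeff
  rw [integral_mul_testFun hG hf, form] at hmain
  have hend : T.dualPt k G i (j + 1) = T.node G i' j' := by
    rcases hnext with ⟨rfl, rfl⟩ | ⟨rfl, rfl, rfl⟩
    · exact dualPt_eq_node hj1'.2
    · exact dualPt_succ (by omega)
  have hcell : ∀ F : ℕ → ℕ → ℝ,
      ∑ a ∈ Finset.Icc 1 T.N, ∑ b ∈ Finset.Icc 1 k, v a b * F a b = F i j := by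
    intro F
    rw [double_sum_eq_single hi hj]
    · simp [hv]
    · intro a _ b hb hne
      rw [Finset.mem_Icc] at hb
      simp only [hv]
      rw [if_neg (by omega), zero_mul]
  have hprev : ∀ F : ℕ → ℕ → ℝ,
      ∑ a ∈ Finset.Icc 1 T.N, ∑ b ∈ Finset.Icc 1 k, v a (b - 1) * F a b = F i' j' := by
    intro F
    rw [double_sum_eq_single hi' hj']
    · simp only [hv]
      rw [if_pos (by omega), one_mul]
    · intro a _ b hb hne
      rw [Finset.mem_Icc] at hb
      simp only [hv]
      rw [if_neg (by omega), zero_mul]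
  simp only [sub_mul, Finset.sum_sub_distrib] at hmain
  rw [hcell, hcell, hcell, hprev, hend, dualPt_eq_node hj1.2, dualPt_eq_node hj1'.2] at hmain
  linarith

/-- The discrete flux is the primitive of the source at all dual points, up to one constant. -/
theorem IsFVESolution.exists_flux_eq {p q r f : ℝ → ℝ} (hk : 1 ≤ k) (hG : IsSymmDualPoints k G)
    (hf : IntegrableOn f (Ioo (0 : ℝ) 1)) (hw : T.IsFVESolution k G p q r f w)
    (hH : IntervalIntegrable (fun y => q y * deriv w y + r y * w y) volume 0 1) :
    ∃ c, ∀ i ∈ Finset.Icc 1 T.N, ∀ j ∈ Finset.Icc 1 k,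
      p (T.node G i j) * deriv w (T.node G i j)
        = c + ∫ y in (0 : ℝ)..(T.node G i j), (q y * deriv w y + r y * w y - f y) := by
  have hf' : IntervalIntegrable f volume 0 1 :=
    (intervalIntegrable_iff_integrableOn_Ioo_of_le zero_le_one).2 hf
  set S : ℝ → ℝ := fun x => ∫ y in (0 : ℝ)..x, (q y * deriv w y + r y * w y - f y) with hS
  have hSP : IsPrimitive 0 1 S (fun y => q y * deriv w y + r y * w y - f y) :=
    ⟨hH.sub hf', fun x _ => by simp [hS]⟩
  set J : ℕ → ℕ → ℝ := fun i j =>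
    p (T.node G i j) * deriv w (T.node G i j) - S (T.node G i j) with hJ
  have hstep : ∀ {i j i' j' : ℕ}, i ∈ Finset.Icc 1 T.N → j ∈ Finset.Icc 1 k →
      i' ∈ Finset.Icc 1 T.N → j' ∈ Finset.Icc 1 k →
      ((i' = i ∧ j' = j + 1) ∨ (i' = i + 1 ∧ j' = 1 ∧ j = k)) → J i' j' = J i j := by
    intro i j i' j' hi hj hi' hj' hnext
    have h1 := hw.flux_sub_eq hG hf hi hj hi' hj' hnext
    have hn := node_mem_Icc hG hi hj
    have hn' := node_mem_Icc hG hi' hj'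
    have hsub : uIcc (T.node G i j) (T.node G i' j') ⊆ uIcc 0 1 := by
      rw [uIcc_of_le (zero_le_one (α := ℝ))]; exact uIcc_subset_Icc hn hn'
    have h2 := hSP.sub_eq hn hn'
    rw [intervalIntegral.integral_sub (hH.mono_set hsub) (hf'.mono_set hsub)] at h2
    simp only [hJ]
    linarith
  have hrow : ∀ i ∈ Finset.Icc 1 T.N, ∀ j, 1 ≤ j → j ≤ k → J i j = J i 1 := by
    intro i hi j hj
    induction j, hj using Nat.le_induction with
    | base => intro _; rfl
    | succ j hj ih =>
      intro hjk
      rw [← ih (by omega)]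
      exact hstep hi (Finset.mem_Icc.2 ⟨hj, by omega⟩) hi (Finset.mem_Icc.2 ⟨by omega, hjk⟩)
        (Or.inl ⟨rfl, rfl⟩)
  have hcol : ∀ i, 1 ≤ i → i ≤ T.N → J i 1 = J 1 1 := by
    intro i hi
    induction i, hi using Nat.le_induction with
    | base => intro _; rfl
    | succ i hi ih =>
      intro hiN
      have hi' : i ∈ Finset.Icc 1 T.N := Finset.mem_Icc.2 ⟨hi, by omega⟩
      rw [← ih (by omega), ← hrow i hi' k hk le_rfl]
      exact hstep hi' (Finset.mem_Icc.2 ⟨hk, le_rfl⟩) (Finset.mem_Icc.2 ⟨by omega, hiN⟩)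
        (Finset.mem_Icc.2 ⟨le_rfl, hk⟩) (Or.inr ⟨rfl, rfl, rfl⟩)
  refine ⟨J 1 1, fun i hi j hj => ?_⟩
  have hi1 := Finset.mem_Icc.1 hi
  have hj1 := Finset.mem_Icc.1 hj
  rw [← hcol i hi1.1 hi1.2, ← hrow i hi j hj1.1 hj1.2]
  simp only [hJ, hS]
  ring

end Mesh

/-- The flux `p u'` of a weak solution is absolutely continuous. -/
theorem IsWeakSolution.exists_flux {p q r f u : ℝ → ℝ} {M p₀ : ℝ}
    (hc : IsBoundedCoeff p q r M p₀) (hf : MemLp f 2 (volume.restrict (Ioo (0 : ℝ) 1)))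
    (hu : IsWeakSolution p q r f u) :
    ∃ v, IsPrimitive 0 1 v (fun y => q y * weakDeriv 0 1 1 u y + r y * u y - f y) ∧
      ∀ᵐ x ∂(volume.restrict (Ioo (0 : ℝ) 1)), p x * weakDeriv 0 1 1 u x = v x := by
  have h01 : (0 : ℝ) ≤ 1 := zero_le_one
  have hiff : ∀ {g : ℝ → ℝ}, IntervalIntegrable g volume 0 1 → IntegrableOn g (Ioo 0 1) :=
    fun hg => (intervalIntegrable_iff_integrableOn_Ioo_of_le h01).1 hg
  set du := weakDeriv 0 1 1 u with hdu
  have hdui : IntervalIntegrable du volume 0 1 :=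
    (hu.1.1.memLp le_rfl).intervalIntegrable_of_le h01
  have hui : IntervalIntegrable u volume 0 1 := by
    refine ContinuousOn.intervalIntegrable ?_
    rw [uIcc_of_le h01]; exact hu.1.2.1
  have hpi := hdui.bdd_mul_of_ae h01 hc.p_meas hc.p_le
  have hqi := hdui.bdd_mul_of_ae h01 hc.q_meas hc.q_le
  have hri := hui.bdd_mul_of_ae h01 hc.r_meas hc.r_le
  have hfi := hf.intervalIntegrable_of_le h01
  have hsi : IntervalIntegrable (fun y => q y * du y + r y * u y - f y) volume 0 1 :=
    (hqi.add hri).sub hfi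
  refine HasWeakDeriv.exists_isPrimitive ⟨(hiff hpi).locallyIntegrableOn,
    (hiff hsi).locallyIntegrableOn, fun φ hφ => ?_⟩ zero_lt_one hsi
  have h1 := hu.2 φ hφ
  have i1 := integrableOn_mul_test (hiff hpi).locallyIntegrableOn hφ.deriv
  have i2 := integrableOn_mul_test (hiff (hqi.add hri)).locallyIntegrableOn hφ
  have i3 := integrableOn_mul_test (hiff hfi).locallyIntegrableOn hφ
  have e1 : ∀ x, p x * weakDeriv 0 1 1 u x * deriv φ x + q x * weakDeriv 0 1 1 u x * φ x
      + r x * u x * φ x = p x * du x * deriv φ x + (q x * du x + r x * u x) * φ x := fun x => by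
    rw [hdu]; ring
  simp only [e1] at h1
  rw [integral_add i1 i2] at h1
  rw [iteratedDeriv_one, pow_one]
  simp only [sub_mul]
  rw [integral_sub i2 i3]
  linarith

end FVE

/-! ### The error estimate -/

namespace FVE

theorem seminormSq_nonneg (a b : ℝ) (j : ℕ) (u : ℝ → ℝ) : 0 ≤ seminormSq a b j u :=
  integral_nonneg fun _ => sq_nonneg _

theorem MemH01.isPrimitive {u : ℝ → ℝ} (hu : MemH01 u) : IsPrimitive 0 1 u (weakDeriv 0 1 1 u) :=
  (hu.1.hasWeakDeriv le_rfl).isPrimitive zero_lt_one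
    ((hu.1.memLp le_rfl).intervalIntegrable_of_le zero_le_one) hu.2.1

/-- On an element, the derivative of a function that is piecewise in `H^{k+1}` has a continuous
representative which is within `O(h^{k - 1/2})` of a polynomial of degree less than `k`. -/
theorem Mesh.MemBroken.exists_polynomial_approx {T : Mesh} {k i : ℕ} {u : ℝ → ℝ} (hk : 1 ≤ k)
    (hu : T.MemBroken (k + 1) u) (hu1 : MemSobolev 0 1 1 u) (hi : i ∈ Finset.Icc 1 T.N) :
    ∃ v, ContinuousOn v (Icc (T.x (i - 1)) (T.x i)) ∧
      (∀ᵐ x ∂(volume.restrict (Ioo (T.x (i - 1)) (T.x i))), weakDeriv 0 1 1 u x = v x) ∧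
      ∃ P : Polynomial ℝ, P.natDegree < k ∧ ∀ x ∈ Icc (T.x (i - 1)) (T.x i),
        |v x - P.eval x| ≤
          T.len i ^ (k - 1) * √(T.len i * seminormSq (T.x (i - 1)) (T.x i) (k + 1) u) := by
  obtain ⟨m, rfl⟩ : ∃ m, k = m + 1 := ⟨k - 1, by omega⟩
  have hS := hu.2 i hi
  obtain ⟨v, hv, hDv, P, hP, hPv⟩ := FVE.exists_polynomial_approx (Mesh.x_pred_lt hi) m
    (fun j => weakDeriv (T.x (i - 1)) (T.x i) (j + 1) u)
    (fun j hj => (hS.hasWeakDeriv (by omega)).succ (hS.hasWeakDeriv (by omega)))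
    (fun j hj => hS.memLp (by omega))
  refine ⟨v, hv.continuousOn, ?_, P, by omega, hPv⟩
  have h1 : HasWeakDeriv (T.x (i - 1)) (T.x i) 1 u (weakDeriv 0 1 1 u) :=
    (hu1.hasWeakDeriv le_rfl).mono (Mesh.x_pred_mem hi).1 (Mesh.x_mem' hi).2
  filter_upwards [h1.weakDeriv_ae_eq, hDv] with x hx1 hx2
  rw [← hx1, ← hx2]

/-- The error `u - u_h` satisfies the flux balance at all dual points up to a constant, and on each
element its derivative is reproduced by Lagrange interpolation up to the approximation error. -/
theorem exists_nodal_flux {k : ℕ} (hk : 1 ≤ k) {G : ℕ → ℝ} (hG : IsSymmDualPoints k G)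
    {l : ℕ → ℝ → ℝ} {L : ℝ}
    (hlL : ∀ j ∈ Finset.Icc 1 k, ∀ t ∈ Icc (-1 : ℝ) 1, |l j t| ≤ L)
    (hl : ∀ S : Polynomial ℝ, S.natDegree < k → ∀ t,
      S.eval t = ∑ j ∈ Finset.Icc 1 k, l j t * S.eval (G j))
    {p q r f u w : ℝ → ℝ} {M p₀ : ℝ} (hc : IsBoundedCoeff p q r M p₀) {T : Mesh}
    (hp : ∀ i ∈ Finset.Icc 1 T.N, ContinuousOn p (Ioo (T.x (i - 1)) (T.x i)))
    (hf : MemLp f 2 (volume.restrict (Ioo (0 : ℝ) 1)))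
    (hu : IsWeakSolution p q r f u) (huT : T.MemBroken (k + 1) u)
    (hw : T.IsFVESolution k G p q r f w) :
    ∃ (c : ℝ) (D : ℕ → ℕ → ℝ), ∀ i ∈ Finset.Icc 1 T.N,
      (∀ j ∈ Finset.Icc 1 k, p (T.node G i j) * D i j
        = c + lowerPrim q r (fun x => u x - w x) (fun x => weakDeriv 0 1 1 u x - deriv w x)
          (T.node G i j)) ∧
      ∀ᵐ x ∂(volume.restrict (Ioo (T.x (i - 1)) (T.x i))),
        |(weakDeriv 0 1 1 u x - deriv w x) - ∑ j ∈ Finset.Icc 1 k,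
          l j ((2 * x - T.x (i - 1) - T.x i) / (T.x i - T.x (i - 1))) * D i j|
        ≤ (1 + k * L) * (T.len i ^ (k - 1)
          * √(T.len i * seminormSq (T.x (i - 1)) (T.x i) (k + 1) u)) := by
  have h01 : (0 : ℝ) ≤ 1 := zero_le_one
  have hdw := hw.1.isPrimitive
  have hdu := hu.1.isPrimitive
  have hlow : ∀ {F F' : ℝ → ℝ}, IsPrimitive 0 1 F F' →
      IntervalIntegrable (fun y => q y * F' y + r y * F y) volume 0 1 := fun {F F'} hF => by
    refine (hF.integrable.bdd_mul_of_ae h01 hc.q_meas hc.q_le).add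
      (IntervalIntegrable.bdd_mul_of_ae h01 ?_ hc.r_meas hc.r_le)
    refine ContinuousOn.intervalIntegrable ?_
    rw [uIcc_of_le h01]; exact hF.continuousOn
  have hfi := hf.intervalIntegrable_of_le h01
  obtain ⟨cw, hcw⟩ := hw.exists_flux_eq hk hG (hf.integrable one_le_two) (hlow hdw)
  obtain ⟨V, hV, hVu⟩ := hu.exists_flux hc hf
  choose! v hvc hvu P hPdeg hPv using fun i hi => huT.exists_polynomial_approx hk hu.1.1 (i := i) hi
  refine ⟨V 0 - cw, fun i j => v i (T.node G i j) - deriv w (T.node G i j), fun i hi => ⟨?_, ?_⟩⟩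
  · intro j hj
    have hn := Mesh.node_mem_Ioo hG hi hj
    have hn' := Mesh.node_mem_Icc hG hi hj
    -- Both sides are continuous inside the element, so equality almost everywhere is equality.
    have hEq : EqOn (fun x => p x * v i x) V (Ioo (T.x (i - 1)) (T.x i)) := by
      refine Measure.eqOn_Ioo_of_ae_eq (μ := volume) ?_
        ((hp i hi).mul ((hvc i hi).mono Ioo_subset_Icc_self))
        (hV.continuousOn.mono (Ioo_subset_Icc_self.trans (Mesh.Icc_subset hi)))
      filter_upwards [hvu i hi, ae_restrict_of_ae_restrict_of_subset (Mesh.Ioo_subset hi) hVu]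
        with x hx1 hx2
      rw [← hx1, hx2]
    have e1 : p (T.node G i j) * v i (T.node G i j) = V (T.node G i j) := hEq hn
    have hsub : uIcc 0 (T.node G i j) ⊆ uIcc (0 : ℝ) 1 := by
      rw [uIcc_of_le h01]; exact uIcc_subset_Icc ⟨le_rfl, h01⟩ hn'
    have e2 := hV.eq _ hn'
    have e3 := hcw i hi j hj
    rw [intervalIntegral.integral_sub ((hlow hdu).mono_set hsub) (hfi.mono_set hsub)] at e2
    rw [intervalIntegral.integral_sub ((hlow hdw).mono_set hsub) (hfi.mono_set hsub)] at e3
    have e4 : lowerPrim q r (fun x => u x - w x) (fun x => weakDeriv 0 1 1 u x - deriv w x)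
        (T.node G i j) = (∫ y in (0 : ℝ)..(T.node G i j), (q y * weakDeriv 0 1 1 u y + r y * u y))
          - ∫ y in (0 : ℝ)..(T.node G i j), (q y * deriv w y + r y * w y) := by
      rw [← intervalIntegral.integral_sub ((hlow hdu).mono_set hsub) ((hlow hdw).mono_set hsub),
        lowerPrim]
      refine intervalIntegral.integral_congr fun y _ => ?_
      ring
    rw [e4, mul_sub, e1, e2, e3]
    ring
  · obtain ⟨W, hWdeg, -, hWd⟩ := hw.1.exists_polynomial hi
    have hlt := Mesh.x_pred_lt hi
    set B := T.len i ^ (k - 1) * √(T.len i * seminormSq (T.x (i - 1)) (T.x i) (k + 1) u) with hB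
    have hSdeg : (P i - W.derivative).natDegree < k := by
      refine lt_of_le_of_lt (Polynomial.natDegree_sub_le _ _) (max_lt (hPdeg i hi) ?_)
      have := Polynomial.natDegree_derivative_le W
      omega
    filter_upwards [hvu i hi, ae_restrict_mem measurableSet_Ioo] with x hx1 hx2
    have ht : (2 * x - T.x (i - 1) - T.x i) / (T.x i - T.x (i - 1)) ∈ Icc (-1 : ℝ) 1 := by
      have := sub_pos.2 hlt
      constructor
      · rw [le_div_iff₀ this]; linarith [hx2.1]
      · rw [div_le_iff₀ this]; linarith [hx2.2]
    have hinterp := lagrange_eval_affine hl hlt _ hSdeg x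
    set t := (2 * x - T.x (i - 1) - T.x i) / (T.x i - T.x (i - 1)) with htdef
    have hnode : ∀ j, (T.x i + T.x (i - 1) + (T.x i - T.x (i - 1)) * G j) / 2 = T.node G i j :=
      fun _ => rfl
    simp only [hnode] at hinterp
    have e1 : (weakDeriv 0 1 1 u x - deriv w x)
        - ∑ j ∈ Finset.Icc 1 k, l j t * (v i (T.node G i j) - deriv w (T.node G i j))
        = (v i x - (P i).eval x)
          - ∑ j ∈ Finset.Icc 1 k, l j t * (v i (T.node G i j) - (P i).eval (T.node G i j)) := by
      have e2 : ∑ j ∈ Finset.Icc 1 k, l j t * (v i (T.node G i j) - deriv w (T.node G i j))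
          = ∑ j ∈ Finset.Icc 1 k, l j t * (v i (T.node G i j) - (P i).eval (T.node G i j))
            + (P i - W.derivative).eval x := by
        rw [hinterp, ← Finset.sum_add_distrib]
        refine Finset.sum_congr rfl fun j hj => ?_
        rw [hWd _ (Mesh.node_mem_Ioo hG hi hj), Polynomial.eval_sub]
        ring
      rw [e2, hx1, hWd x hx2, Polynomial.eval_sub]
      ring
    rw [e1]
    have h1 := hPv i hi x (Ioo_subset_Icc_self hx2)
    have h2 : |∑ j ∈ Finset.Icc 1 k, l j t * (v i (T.node G i j) - (P i).eval (T.node G i j))|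
        ≤ k * (L * B) := by
      refine (Finset.abs_sum_le_sum_abs _ _).trans ?_
      have h3 : ∀ j ∈ Finset.Icc 1 k,
          |l j t * (v i (T.node G i j) - (P i).eval (T.node G i j))| ≤ L * B := fun j hj => by
        rw [abs_mul]
        exact mul_le_mul (hlL j hj t ht)
          (hPv i hi _ (Ioo_subset_Icc_self (Mesh.node_mem_Ioo hG hi hj))) (abs_nonneg _)
          ((abs_nonneg _).trans (hlL j hj t ht))
      simpa [Nat.card_Icc] using Finset.sum_le_sum h3
    have h4 := abs_sub (v i x - (P i).eval x)
      (∑ j ∈ Finset.Icc 1 k, l j t * (v i (T.node G i j) - (P i).eval (T.node G i j)))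
    linarith

theorem Mesh.sq_brokenNorm (T : Mesh) (m : ℕ) (u : ℝ → ℝ) :
    T.brokenNorm m u ^ 2 = ∑ j ∈ Finset.range (m + 1), ∑ i ∈ Finset.Icc 1 T.N,
      seminormSq (T.x (i - 1)) (T.x i) j u :=
  Real.sq_sqrt (Finset.sum_nonneg fun _ _ => Finset.sum_nonneg fun _ _ => seminormSq_nonneg _ _ _ _)

theorem Mesh.sum_len_mul_sq_le (T : Mesh) {k : ℕ} (hk : 1 ≤ k) (u : ℝ → ℝ) :
    ∑ i ∈ Finset.Icc 1 T.N, T.len i * (T.len i ^ (k - 1)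
        * √(T.len i * seminormSq (T.x (i - 1)) (T.x i) (k + 1) u)) ^ 2
      ≤ (T.h ^ k * T.brokenNorm (k + 1) u) ^ 2 := by
  obtain ⟨m, rfl⟩ : ∃ m, k = m + 1 := ⟨k - 1, by omega⟩
  have h1 : ∀ i ∈ Finset.Icc 1 T.N, T.len i * (T.len i ^ (m + 1 - 1)
        * √(T.len i * seminormSq (T.x (i - 1)) (T.x i) (m + 1 + 1) u)) ^ 2
      ≤ (T.h ^ (m + 1)) ^ 2 * seminormSq (T.x (i - 1)) (T.x i) (m + 1 + 1) u := by
    intro i hi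
    have hl := Mesh.len_pos hi
    have hs := seminormSq_nonneg (T.x (i - 1)) (T.x i) (m + 1 + 1) u
    rw [mul_pow, Real.sq_sqrt (mul_nonneg hl.le hs), Nat.add_sub_cancel]
    have e : T.len i * ((T.len i ^ m) ^ 2
          * (T.len i * seminormSq (T.x (i - 1)) (T.x i) (m + 1 + 1) u))
        = (T.len i ^ (m + 1)) ^ 2 * seminormSq (T.x (i - 1)) (T.x i) (m + 1 + 1) u := by ring
    rw [e]
    exact mul_le_mul_of_nonneg_right (pow_le_pow_left₀ (by positivity)
      (pow_le_pow_left₀ hl.le (Mesh.len_le_h hi) _) 2) hs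
  refine (Finset.sum_le_sum h1).trans ?_
  rw [← Finset.mul_sum, mul_pow, T.sq_brokenNorm]
  refine mul_le_mul_of_nonneg_left ?_ (sq_nonneg _)
  exact Finset.single_le_sum (f := fun j => ∑ i ∈ Finset.Icc 1 T.N,
      seminormSq (T.x (i - 1)) (T.x i) j u)
    (fun _ _ => Finset.sum_nonneg fun _ _ => seminormSq_nonneg _ _ _ _)
    (Finset.mem_range.2 (Nat.lt_succ_self _))

theorem IsAdmissible.sq_sobolevNorm_le {q r e d : ℝ → ℝ} (h : IsAdmissible q r e d) :
    sobolevNorm 0 1 1 e ^ 2 ≤ 2 * ∫ x in (0 : ℝ)..1, d x ^ 2 := by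
  have h01 : (0 : ℝ) ≤ 1 := zero_le_one
  have hW := h.prim.hasWeakDeriv h01
  have hW0 : HasWeakDeriv 0 1 0 e e := ⟨hW.1, hW.1, fun φ _ => by simp⟩
  rw [sobolevNorm, Real.sq_sqrt (Finset.sum_nonneg fun _ _ => seminormSq_nonneg _ _ _ _),
    Finset.sum_range_succ, Finset.sum_range_one, hW0.seminormSq_eq, hW.seminormSq_eq,
    ← integral_Ioc_eq_integral_Ioo, ← integral_Ioc_eq_integral_Ioo,
    ← intervalIntegral.integral_of_le h01, ← intervalIntegral.integral_of_le h01]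
  linarith [h.integral_sq_le]

end FVE

theorem mainTheorem5 (k : ℕ) (hk : 1 ≤ k) (G : ℕ → ℝ) (hG : FVE.IsSymmDualPoints k G)
    (p q r q' : ℝ → ℝ) (p₀ γ : ℝ) (hp₀ : 0 < p₀) (hγ : 0 < γ)
    (hp : MemLp p ⊤ (volume.restrict (Ioo (0 : ℝ) 1)))
    (hq : MemLp q ⊤ (volume.restrict (Ioo (0 : ℝ) 1)))
    (hr : MemLp r ⊤ (volume.restrict (Ioo (0 : ℝ) 1)))
    (hp_lower : ∀ᵐ x ∂(volume.restrict (Ioo (0 : ℝ) 1)), p₀ ≤ p x)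
    (hq' : FVE.HasWeakDeriv 0 1 1 q q')
    (hr_lower : ∀ᵐ x ∂(volume.restrict (Ioo (0 : ℝ) 1)), γ ≤ r x - q' x / 2) :
    ∃ C : ℝ, 0 < C ∧ ∃ h₀ : ℝ, 0 < h₀ ∧
      ∀ T : FVE.Mesh, T.h ≤ h₀ →
        (∀ i ∈ Finset.Icc 1 T.N, ContinuousOn p (Ioo (T.x (i - 1)) (T.x i))) →
        ∀ f : ℝ → ℝ, MemLp f 2 (volume.restrict (Ioo (0 : ℝ) 1)) →
        ∀ u : ℝ → ℝ, FVE.IsWeakSolution p q r f u → T.MemBroken (k + 1) u →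
        ∀ u_h : ℝ → ℝ, T.IsFVESolution k G p q r f u_h →
          FVE.sobolevNorm 0 1 1 (fun x => u x - u_h x) ≤ C * T.h ^ k * T.brokenNorm (k + 1) u := by
  obtain ⟨Mp, hMp, hpM⟩ := FVE.ae_abs_le_of_memLp_top hp
  obtain ⟨Mq, hMq, hqM⟩ := FVE.ae_abs_le_of_memLp_top hq
  obtain ⟨Mr, hMr, hrM⟩ := FVE.ae_abs_le_of_memLp_top hr
  -- One bound for all three coefficients.
  set M := Mp + Mq + Mr with hM
  have hc : FVE.IsBoundedCoeff p q r M p₀ := by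
    refine ⟨by positivity, hp₀, hp.1, hq.1, hr.1, ?_, ?_, ?_, hp_lower⟩
    · filter_upwards [hpM] with x hx; linarith
    · filter_upwards [hqM] with x hx; linarith
    · filter_upwards [hrM] with x hx; linarith
  have hMpos := hc.M_pos
  have hGinj : InjOn G (Finset.Icc 1 k) := by
    intro i hi j hj hij
    rcases lt_trichotomy i j with h | h | h
    · exact absurd hij (hG.lt i hi j hj h).ne
    · exact h
    · exact absurd hij (hG.lt j hj i hi h).ne'
  obtain ⟨l, L, hL, hlL, hl⟩ := FVE.exists_lagrange_coeff k G hGinj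
  have hl1 : ∀ t, ∑ j ∈ Finset.Icc 1 k, l j t = 1 := fun t => by
    have := hl 1 (by simp; omega) t
    simpa using this.symm
  set K₁ := L ^ 2 * k ^ 2 * FVE.nodalConst M p₀ with hK₁
  have hK₁0 : 0 ≤ K₁ := by rw [hK₁]; unfold FVE.nodalConst; positivity
  set K₂ := 4 * L ^ 2 * k ^ 2 * M ^ 2 / p₀ ^ 2 with hK₂
  have hK₂0 : 0 ≤ K₂ := by positivity
  -- With this tolerance, and `h ≤ 1 / (12 (K₂ + 1))`, the defect is absorbed by itself.
  set ε := 1 / (12 * (K₁ + 1)) with hε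
  have hε0 : 0 < ε := by positivity
  choose! H hH0 hH using fun j (hj : j ∈ Finset.Icc 1 k) =>
    FVE.Mesh.exists_oscillation_le hc.p_meas hc.p_le (hG.mem j hj) hε0
  have hne : (Finset.Icc 1 k).Nonempty := Finset.nonempty_Icc.2 hk
  refine ⟨4 * M * (1 + k * L) / p₀, by positivity,
    min ((Finset.Icc 1 k).inf' hne H) (1 / (12 * (K₂ + 1))),
    lt_min ((Finset.lt_inf'_iff hne).2 hH0) (by positivity), ?_⟩
  intro T hTh hpT f hf u hu huT u_h hw
  obtain ⟨c, D, hD⟩ := FVE.exists_nodal_flux hk hG hlL hl hc hpT hf hu huT hw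
  set e : ℝ → ℝ := fun x => u x - u_h x with he
  set d : ℝ → ℝ := fun x => FVE.weakDeriv 0 1 1 u x - deriv u_h x with hd
  have hprim : FVE.IsPrimitive 0 1 e d := hu.1.isPrimitive.sub hw.1.isPrimitive
  have he0 : e 0 = 0 := by simp only [he]; rw [hu.1.2.2.1, hw.1.2.1, sub_zero]
  have he1 : e 1 = 0 := by simp only [he]; rw [hu.1.2.2.2, hw.1.2.2.1, sub_zero]
  have hadm : FVE.IsAdmissible q r e d :=
    ⟨hprim, he0, he1, (hu.1.1.memLp le_rfl).sub hw.1.memLp_deriv,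
      FVE.integral_lowerOrder_nonneg hc.q_meas hc.r_meas hc.q_le hc.r_le hq'
        (by filter_upwards [hr_lower] with x hx; exact hγ.le.trans hx) hprim he0 he1⟩
  have hpn : ∀ i ∈ Finset.Icc 1 T.N, ∀ j ∈ Finset.Icc 1 k, p₀ ≤ p (T.node G i j) := by
    intro i hi j hj
    have h1 : EqOn (fun x => max p₀ (p x)) p (Ioo (T.x (i - 1)) (T.x i)) := by
      refine Measure.eqOn_Ioo_of_ae_eq (μ := volume) ?_
        (continuousOn_const.sup (hpT i hi)) (hpT i hi)
      filter_upwards [ae_restrict_of_ae_restrict_of_subset (FVE.Mesh.Ioo_subset hi) hp_lower]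
        with x hx
      exact max_eq_right hx
    exact max_eq_right_iff.1 (h1 (FVE.Mesh.node_mem_Ioo hG hi hj))
  set A := ∫ x in (0 : ℝ)..1, FVE.fluxDefect p q r e d c x ^ 2 with hA
  have hA0 : 0 ≤ A := FVE.integral_sq_fluxDefect_nonneg
  have hmain := hadm.integral_sq_fluxDefect_le hc (T := T) hG.mem hlL hl1 (D := D) (c := c)
    (ε := ε) (fun i hi => (hD i hi).1) hpn (fun i hi => (hD i hi).2)
    (fun j hj => hH j hj T ((hTh.trans (min_le_left _ _)).trans (Finset.inf'_le _ hj)) hpT)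
  rw [← hA, ← hK₁, ← hK₂] at hmain
  have hsum : ∑ i ∈ Finset.Icc 1 T.N, T.len i * ((1 + k * L) * (T.len i ^ (k - 1)
        * √(T.len i * FVE.seminormSq (T.x (i - 1)) (T.x i) (k + 1) u))) ^ 2
      ≤ (1 + k * L) ^ 2 * (T.h ^ k * T.brokenNorm (k + 1) u) ^ 2 := by
    refine le_trans (le_of_eq ?_)
      (mul_le_mul_of_nonneg_left (T.sum_len_mul_sq_le hk u) (sq_nonneg _))
    rw [Finset.mul_sum]
    exact Finset.sum_congr rfl fun i _ => by ring
  set U := T.h ^ k * T.brokenNorm (k + 1) u with hU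
  have hU0 : 0 ≤ U := mul_nonneg (pow_nonneg FVE.Mesh.h_pos.le _) (Real.sqrt_nonneg _)
  have h1 : K₁ * ε ≤ 1 / 12 := by
    rw [hε, mul_one_div, div_le_iff₀ (by positivity)]; linarith
  have h2 : K₂ * T.h ≤ 1 / 12 := by
    refine (mul_le_mul_of_nonneg_left (hTh.trans (min_le_right _ _)) hK₂0).trans ?_
    rw [mul_one_div, div_le_iff₀ (by positivity)]; linarith
  have h3 : 3 * (K₁ * ε + K₂ * T.h) * A ≤ 1 / 2 * A :=
    mul_le_mul_of_nonneg_right (by linarith) hA0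
  have h4 : A ≤ 6 * M ^ 2 * ((1 + k * L) ^ 2 * U ^ 2) := by
    have := mul_le_mul_of_nonneg_left hsum (show 0 ≤ 3 * M ^ 2 by positivity)
    linarith
  have h5 := hadm.integral_sq_le_div hc c
  rw [← hA] at h5
  have h6 : FVE.sobolevNorm 0 1 1 e ^ 2 ≤ (4 * M * (1 + k * L) / p₀ * U) ^ 2 := by
    refine hadm.sq_sobolevNorm_le.trans ?_
    have e1 : (4 * M * (1 + k * L) / p₀ * U) ^ 2
        = 16 * (M ^ 2 * ((1 + k * L) ^ 2 * U ^ 2)) / p₀ ^ 2 := by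
      ring
    have h7 : 2 * (A / p₀ ^ 2) ≤ 16 * (M ^ 2 * ((1 + k * L) ^ 2 * U ^ 2)) / p₀ ^ 2 := by
      rw [← mul_div_assoc]
      refine div_le_div_of_nonneg_right ?_ (by positivity)
      have : 0 ≤ M ^ 2 * ((1 + k * L) ^ 2 * U ^ 2) := by positivity
      linarith
    rw [e1]
    linarith
  rw [mul_assoc, ← hU]
  exact le_of_sq_le_sq h6 (by positivity)
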